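/- Let $N,d\geq 1$ be integers. Let $\mathrm{Hom}_d(\mathbb{P}^N)$ be the set of endomorphisms of $\mathbb{P}^N_{\mathbb{C}}$ of algebraic degree $d$, i.e. those of the form $[x]\mapsto[F_0(x):\dots:F_N(x)]$ with $F_0,\dots,F_N\in\mathbb{C}[x_0,\dots,x_N]$ homogeneous of degree $d$ without common zeros other than the origin. Taking the coefficients of $(F_0,\dots,F_N)$, which is determined up to a common nonzero scalar, embeds $\mathrm{Hom}_d(\mathbb{P}^N)$ into $\mathbb{P}^{N'-1}(\mathbb{C})$, $N'=(N+1)\binom{N+d}{d}$; give it the induced Zariski topology. For an endomorphism $f$ and a point $x\in\mathbb{P}^N(\mathbb{C})$, let $e_f(x)$ be the length of the local ring $\mathcal{O}_{\mathbb{P}^N,x}/f^*\mathfrak{m}_{f(x)}\mathcal{O}_{\mathbb{P}^N,x}$, where $\mathfrak{m}_{f(x)}$ is the maximal ideal of $\mathcal{O}_{\mathbb{P}^N,f(x)}$. Then a general endomorphism of degree $d$ satisfies $\max_x e_f(x)\leq N!\cdot 2^N$: there is a dense open subset $U\subseteq\mathrm{Hom}_d(\mathbb{P}^N)$ such that $$\max_{x\in\mathbb{P}^N(\mathbb{C})}e_f(x)\leq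 N!\cdot 2^N\qquad\text{for every } f\in U.$$ -/

import Mathlib

open CategoryTheory AlgebraicGeometry HomogeneousLocalization
open scoped LinearAlgebra.Projectivization

noncomputable section

namespace GenEnd

universe u

section ProjMap

variable {A B σ τ : Type u} [CommRing A] [SetLike σ A] [AddSubgroupClass σ A]
  [CommRing B] [SetLike τ B] [AddSubgroupClass τ B]

/-- A homomorphism of `ℕ`-graded rings `A → B` that multiplies degrees by `d > 0`, such that no
relevant homogeneous prime of `B` has a preimage containing the irrelevant ideal of `A`. These are
the conditions under which it induces a morphism `Proj B ⟶ Proj A`. -/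
structure ScaledHom (𝒜 : ℕ → σ) (ℬ : ℕ → τ) [GradedRing 𝒜] [GradedRing ℬ] (d : ℕ) where
  toRingHom : A →+* B
  pos : 0 < d
  map_mem : ∀ {n : ℕ} {a : A}, a ∈ 𝒜 n → toRingHom a ∈ ℬ (d * n)
  relevant : ∀ p : ProjectiveSpectrum ℬ,
    ¬ (HomogeneousIdeal.irrelevant 𝒜).toIdeal ≤ p.asHomogeneousIdeal.toIdeal.comap toRingHom

namespace ScaledHom

variable {𝒜 : ℕ → σ} {ℬ : ℕ → τ} [GradedRing 𝒜] [GradedRing ℬ] {d : ℕ} (φ : ScaledHom 𝒜 ℬ d)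

lemma decompose_map (a : A) (n : ℕ) :
    (DirectSum.decompose ℬ (φ.toRingHom a) (d * n) : B) =
      φ.toRingHom (DirectSum.decompose 𝒜 a n : A) := by
  induction a using DirectSum.Decomposition.inductionOn 𝒜 with
  | zero => simp
  | @homogeneous m a =>
    by_cases h : m = n
    · subst h
      rw [DirectSum.decompose_of_mem_same ℬ (φ.map_mem a.2), DirectSum.decompose_of_mem_same 𝒜 a.2]
    · rw [DirectSum.decompose_of_mem_ne ℬ (φ.map_mem a.2)
        (fun e => h (Nat.eq_of_mul_eq_mul_left φ.pos e)), DirectSum.decompose_of_mem_ne 𝒜 a.2 h,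
        map_zero]
  | add a b ha hb => simp [DirectSum.decompose_add, ha, hb]

/-- The map on homogeneous primes, `p ↦ φ⁻¹(p)`. -/
def comapPoint (p : ProjectiveSpectrum ℬ) : ProjectiveSpectrum 𝒜 where
  asHomogeneousIdeal :=
    ⟨p.asHomogeneousIdeal.toIdeal.comap φ.toRingHom, fun n a ha => by
      have h := p.asHomogeneousIdeal.isHomogeneous (d * n) (Ideal.mem_comap.1 ha)
      rw [decompose_map] at h
      exact h⟩
  isPrime := Ideal.IsPrime.comap _
  not_irrelevant_le := φ.relevant p

lemma mem_comapPoint (p : ProjectiveSpectrum ℬ) (a : A) :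
    a ∈ (φ.comapPoint p).asHomogeneousIdeal ↔ φ.toRingHom a ∈ p.asHomogeneousIdeal := Iff.rfl

/-- The continuous map `Proj ℬ → Proj 𝒜`. -/
def comap : C(ProjectiveSpectrum ℬ, ProjectiveSpectrum 𝒜) where
  toFun := φ.comapPoint
  continuous_toFun := by
    simp_rw [continuous_iff_isClosed, ProjectiveSpectrum.isClosed_iff_zeroLocus, exists_imp,
      forall_eq_apply_imp_iff]
    refine fun s => ⟨φ.toRingHom '' s, ?_⟩
    ext p
    simp only [Set.mem_preimage, ProjectiveSpectrum.mem_zeroLocus, Set.image_subset_iff]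
    rfl

lemma map_notMem {p : ProjectiveSpectrum ℬ} {s : A}
    (hs : s ∈ (φ.comap p).asHomogeneousIdeal.toIdeal.primeCompl) :
    φ.toRingHom s ∈ p.asHomogeneousIdeal.toIdeal.primeCompl := hs

/-- The fraction `φ a / φ s` for a fraction `a / s`. -/
def mapFrac (p : ProjectiveSpectrum ℬ)
    (x : NumDenSameDeg 𝒜 (φ.comap p).asHomogeneousIdeal.toIdeal.primeCompl) :
    NumDenSameDeg ℬ p.asHomogeneousIdeal.toIdeal.primeCompl where
  deg := d * x.deg
  num := ⟨φ.toRingHom x.num, φ.map_mem x.num.2⟩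
  den := ⟨φ.toRingHom x.den, φ.map_mem x.den.2⟩
  den_mem := φ.map_notMem x.den_mem

lemma ideal_comap (p : ProjectiveSpectrum ℬ) : (φ.comap p).asHomogeneousIdeal.toIdeal =
    p.asHomogeneousIdeal.toIdeal.comap φ.toRingHom := rfl

lemma embedding_mapFrac (p : ProjectiveSpectrum ℬ)
    (x : NumDenSameDeg 𝒜 (φ.comap p).asHomogeneousIdeal.toIdeal.primeCompl) :
    (φ.mapFrac p x).embedding =
      Localization.localRingHom (φ.comap p).asHomogeneousIdeal.toIdeal
        p.asHomogeneousIdeal.toIdeal φ.toRingHom (φ.ideal_comap p) x.embedding := by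
  exact (Localization.localRingHom_mk (φ.comap p).asHomogeneousIdeal.toIdeal
    p.asHomogeneousIdeal.toIdeal φ.toRingHom (φ.ideal_comap p) x.num ⟨x.den, x.den_mem⟩).symm

/-- The map of local rings `𝒜_(φ⁻¹ p) → ℬ_(p)`, `a / s ↦ φ a / φ s`. -/
def localFun (p : ProjectiveSpectrum ℬ) :
    AtPrime 𝒜 (φ.comap p).asHomogeneousIdeal.toIdeal →
      AtPrime ℬ p.asHomogeneousIdeal.toIdeal :=
  Quotient.map' (φ.mapFrac p) fun x y (e : x.embedding = y.embedding) => by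
    change (φ.mapFrac p x).embedding = (φ.mapFrac p y).embedding
    rw [embedding_mapFrac, embedding_mapFrac, e]

lemma localFun_mk (p : ProjectiveSpectrum ℬ)
    (x : NumDenSameDeg 𝒜 (φ.comap p).asHomogeneousIdeal.toIdeal.primeCompl) :
    φ.localFun p (HomogeneousLocalization.mk x) = HomogeneousLocalization.mk (φ.mapFrac p x) := rfl

lemma val_localFun (p : ProjectiveSpectrum ℬ)
    (x : AtPrime 𝒜 (φ.comap p).asHomogeneousIdeal.toIdeal) :
    (φ.localFun p x).val = Localization.localRingHom (φ.comap p).asHomogeneousIdeal.toIdeal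
        p.asHomogeneousIdeal.toIdeal φ.toRingHom (φ.ideal_comap p) x.val := by
  obtain ⟨c, rfl⟩ := x.mk_surjective
  exact φ.embedding_mapFrac p c

/-- The homomorphism of local rings `𝒜_(φ⁻¹ p) → ℬ_(p)`, `a / s ↦ φ a / φ s`. -/
def localHom (p : ProjectiveSpectrum ℬ) :
    AtPrime 𝒜 (φ.comap p).asHomogeneousIdeal.toIdeal →+*
      AtPrime ℬ p.asHomogeneousIdeal.toIdeal where
  toFun := φ.localFun p
  map_one' := val_injective _ (by simp [val_localFun])
  map_zero' := val_injective _ (by simp [val_localFun])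
  map_add' x y := val_injective _ (by simp [val_localFun])
  map_mul' x y := val_injective _ (by simp [val_localFun])

lemma localHom_mk (p : ProjectiveSpectrum ℬ)
    (x : NumDenSameDeg 𝒜 (φ.comap p).asHomogeneousIdeal.toIdeal.primeCompl) :
    φ.localHom p (HomogeneousLocalization.mk x) = HomogeneousLocalization.mk (φ.mapFrac p x) := rfl

instance (p : ProjectiveSpectrum ℬ) : IsLocalHom (φ.localHom p) where
  map_nonunit x hx := by
    rw [← isUnit_iff_isUnit_val] at hx ⊢
    have h : (φ.localHom p x).val = _ := φ.val_localFun p x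
    rw [h] at hx
    have := Localization.isLocalHom_localRingHom (φ.comap p).asHomogeneousIdeal.toIdeal
        p.asHomogeneousIdeal.toIdeal φ.toRingHom (φ.ideal_comap p)
    exact IsLocalHom.map_nonunit _ hx

section Sections

variable (U : TopologicalSpace.Opens (ProjectiveSpectrum 𝒜))
  (V : TopologicalSpace.Opens (ProjectiveSpectrum ℬ)) (hUV : V.1 ⊆ φ.comap ⁻¹' U.1)

/-- The map on families of germs. -/
def sectionFun (s : ∀ x : U, AtPrime 𝒜 x.1.asHomogeneousIdeal.toIdeal) (y : V) :
    AtPrime ℬ y.1.asHomogeneousIdeal.toIdeal :=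
  φ.localHom y.1 (s ⟨φ.comap y.1, hUV y.2⟩)

open ProjectiveSpectrum.StructureSheaf in
lemma isLocallyFraction_sectionFun
    (s : ∀ x : U, AtPrime 𝒜 x.1.asHomogeneousIdeal.toIdeal)
    (hs : (isLocallyFraction 𝒜).pred s) :
    (isLocallyFraction ℬ).pred (φ.sectionFun U V hUV s) := by
  rintro ⟨p, hpV⟩
  rcases hs ⟨φ.comap p, hUV hpV⟩ with ⟨W, m, iWU, i, a, b, hb, h_frac⟩
  refine ⟨W.comap φ.comap ⊓ V, ⟨m, hpV⟩, TopologicalSpace.Opens.infLERight _ _, d * i,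
    ⟨φ.toRingHom a, φ.map_mem a.2⟩, ⟨φ.toRingHom b, φ.map_mem b.2⟩,
    fun ⟨q, ⟨hqW, hqV⟩⟩ => hb ⟨_, hqW⟩, fun ⟨q, ⟨hqW, hqV⟩⟩ => ?_⟩
  have h := h_frac ⟨_, hqW⟩
  change φ.localHom q (s ⟨φ.comap q, _⟩) = _
  have h' : s ⟨φ.comap q, hUV hqV⟩ = _ := h
  rw [h']
  rfl

/-- The ring homomorphism on sections. -/
def sectionHom :
    (ProjectiveSpectrum.Proj.structureSheaf 𝒜).1.obj (.op U) →+*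
      (ProjectiveSpectrum.Proj.structureSheaf ℬ).1.obj (.op V) where
  toFun s := ⟨φ.sectionFun U V hUV s.1, φ.isLocallyFraction_sectionFun U V hUV _ s.2⟩
  map_one' := Subtype.ext (funext fun y => map_one (φ.localHom y.1))
  map_zero' := Subtype.ext (funext fun y => map_zero (φ.localHom y.1))
  map_add' _ _ := Subtype.ext (funext fun y => map_add (φ.localHom y.1) _ _)
  map_mul' _ _ := Subtype.ext (funext fun y => map_mul (φ.localHom y.1) _ _)

end Sections

open ProjectiveSpectrum

/-- The morphism of sheafed spaces `Proj ℬ ⟶ Proj 𝒜`. -/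
def sheafedSpaceMap : Proj.toSheafedSpace ℬ ⟶ Proj.toSheafedSpace 𝒜 where
  hom :=
    { base := TopCat.ofHom φ.comap
      c := { app U := ConcreteCategory.ofHom (C := CommRingCat)
                        (φ.sectionHom _ _ Set.Subset.rfl) } }

lemma germ_map_sectionInBasicOpen {p : ProjectiveSpectrum ℬ}
    (c : NumDenSameDeg 𝒜 (φ.comap p).asHomogeneousIdeal.toIdeal.primeCompl) :
    (Proj.toSheafedSpace ℬ).presheaf.germ
      ((TopologicalSpace.Opens.map φ.sheafedSpaceMap.hom.base).obj _) p
        (mem_basicOpen_den _ _ _)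
      (φ.sheafedSpaceMap.hom.c.app _ (sectionInBasicOpen 𝒜 _ c)) =
    (Proj.toSheafedSpace ℬ).presheaf.germ
      (ProjectiveSpectrum.basicOpen _ (φ.toRingHom c.den)) p (φ.map_notMem c.4)
      (sectionInBasicOpen ℬ p (φ.mapFrac p c)) :=
  rfl

/-- On stalks the morphism is `localHom`. -/
theorem stalkMap_symm_apply (p : ProjectiveSpectrum ℬ)
    (x : AtPrime 𝒜 (φ.comap p).asHomogeneousIdeal.toIdeal) :
    (φ.sheafedSpaceMap.hom.stalkMap p).hom ((Proj.stalkIso' 𝒜 (φ.comap p)).symm x) =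
      (Proj.stalkIso' ℬ p).symm (φ.localHom p x) := by
  obtain ⟨c, rfl⟩ := x.mk_surjective
  refine (congrArg (φ.sheafedSpaceMap.hom.stalkMap p).hom
    (Proj.stalkIso'_symm_mk 𝒜 (φ.comap p) c)).trans ?_
  refine (PresheafedSpace.stalkMap_germ_apply φ.sheafedSpaceMap.hom _ p _ _).trans ?_
  exact (φ.germ_map_sectionInBasicOpen c).trans (Proj.stalkIso'_symm_mk ℬ p (φ.mapFrac p c)).symm

theorem isLocalHom_stalkMap (p : ProjectiveSpectrum ℬ) :
    IsLocalHom (φ.sheafedSpaceMap.hom.stalkMap p).hom := by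
  refine ⟨fun x hx => ?_⟩
  obtain ⟨y, rfl⟩ := (Proj.stalkIso' 𝒜 (φ.comap p)).symm.surjective x
  have h1 : IsUnit ((Proj.stalkIso' ℬ p).symm (φ.localHom p y)) :=
    (φ.stalkMap_symm_apply p y) ▸ hx
  have h2 : IsUnit (φ.localHom p y) := by
    have := h1.map (Proj.stalkIso' ℬ p)
    rwa [RingEquiv.apply_symm_apply] at this
  exact (IsLocalHom.map_nonunit y h2).map (Proj.stalkIso' 𝒜 (φ.comap p)).symm

/-- The morphism of schemes `Proj ℬ ⟶ Proj 𝒜`. -/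
def projMap : Proj ℬ ⟶ Proj 𝒜 where
  __ := φ.sheafedSpaceMap.hom
  prop p := φ.isLocalHom_stalkMap p

end ScaledHom
end ProjMap

section Multiplicity

/-- The multiplicity `e_f(x)` of a morphism of schemes `f : X ⟶ Y` at `x`: the length of the local
ring `𝒪_{X,x} / f^*𝔪_{f(x)} 𝒪_{X,x}`. It is infinite unless this ring is Artinian. -/
def multiplicity {X Y : Scheme.{u}} (f : X ⟶ Y) (x : X) : ℕ∞ :=
  Module.length (X.presheaf.stalk x)
    (X.presheaf.stalk x ⧸
      (IsLocalRing.maximalIdeal (Y.presheaf.stalk (f x))).map (f.stalkMap x).hom)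

end Multiplicity

open MvPolynomial

attribute [local instance] MvPolynomial.gradedAlgebra

section ProjectiveSpace

variable {ι : Type}

/-- The closed point of `Proj ℂ[x_i : i ∈ ι]` with homogeneous coordinates `x`: the ideal generated
by the homogeneous polynomials that vanish at `x`. -/
def closedPoint (x : ℙ ℂ (ι → ℂ)) : ProjectiveSpectrum (homogeneousSubmodule ι ℂ) where
  asHomogeneousIdeal :=
    (RingHom.ker (MvPolynomial.eval x.rep)).homogeneousCore (homogeneousSubmodule ι ℂ)
  isPrime := Ideal.IsPrime.homogeneousCore (RingHom.ker_isPrime _)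
  not_irrelevant_le h := by
    apply x.rep_nonzero
    funext i
    have hX : (X i : MvPolynomial ι ℂ) ∈ HomogeneousIdeal.irrelevant (homogeneousSubmodule ι ℂ) := by
      rw [HomogeneousIdeal.mem_irrelevant_iff, GradedRing.proj_apply]
      exact DirectSum.decompose_of_mem_ne (homogeneousSubmodule ι ℂ) (isHomogeneous_X ℂ i)
        one_ne_zero
    have := Ideal.toIdeal_homogeneousCore_le _ _ (h hX)
    simpa [RingHom.mem_ker] using this

end ProjectiveSpace

/-- The scheme `ℙ^N` over `ℂ`. -/
abbrev ProjSpace (N : ℕ) : Scheme.{0} := Proj (homogeneousSubmodule (Fin (N + 1)) ℂ)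

/-- The point of the scheme `ℙ^N` defined by an element of `ℙ^N(ℂ)`. -/
def complexPoint {N : ℕ} (x : ℙ ℂ (Fin (N + 1) → ℂ)) : ProjSpace N := closedPoint x

/-- `N + 1` homogeneous polynomials of degree `d` in `N + 1` variables. -/
abbrev FormTuple (N d : ℕ) : Type := Fin (N + 1) → homogeneousSubmodule (Fin (N + 1)) ℂ d

/-- The polynomials have no common zero other than the origin. -/
def NoCommonZero {N d : ℕ} (F : FormTuple N d) : Prop :=
  ∀ v : Fin (N + 1) → ℂ, (∀ i, MvPolynomial.eval v (F i : MvPolynomial (Fin (N + 1)) ℂ) = 0) → v = 0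

/-- The substitution `x_i ↦ F_i`. -/
def substHom {N d : ℕ} (hd : 0 < d) (F : FormTuple N d) (hF : NoCommonZero F) :
    ScaledHom (homogeneousSubmodule (Fin (N + 1)) ℂ) (homogeneousSubmodule (Fin (N + 1)) ℂ) d where
  toRingHom := (aeval fun i => (F i : MvPolynomial (Fin (N + 1)) ℂ)).toRingHom
  pos := hd
  map_mem ha := IsHomogeneous.aeval ha _ fun i => (F i).2
  relevant p h := by
    apply p.not_irrelevant_le
    have hp : p.asHomogeneousIdeal.toIdeal.IsPrime := p.isPrime
    intro q hq
    change q ∈ p.asHomogeneousIdeal.toIdeal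
    rw [← MvPolynomial.IsPrime.vanishingIdeal_zeroLocus (K := ℂ) p.asHomogeneousIdeal.toIdeal,
      mem_vanishingIdeal_iff]
    intro v hv
    have hv0 : v = 0 := hF v fun i => by
      have hX : (X i : MvPolynomial (Fin (N + 1)) ℂ) ∈
          HomogeneousIdeal.irrelevant (homogeneousSubmodule (Fin (N + 1)) ℂ) := by
        rw [HomogeneousIdeal.mem_irrelevant_iff, GradedRing.proj_apply]
        exact DirectSum.decompose_of_mem_ne (homogeneousSubmodule (Fin (N + 1)) ℂ)
          (isHomogeneous_X ℂ i) one_ne_zero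
      have hFi : (F i : MvPolynomial (Fin (N + 1)) ℂ) ∈ p.asHomogeneousIdeal.toIdeal := by
        have := h hX
        rw [Ideal.mem_comap] at this
        simpa using this
      simpa [MvPolynomial.coe_aeval_eq_eval] using (mem_zeroLocus_iff.1 hv) _ hFi
    subst hv0
    have h0 : MvPolynomial.homogeneousComponent 0 q = 0 := by
      rw [HomogeneousIdeal.mem_irrelevant_iff, GradedRing.proj_apply] at hq
      rw [← hq]
      exact (decomposition.decompose'_apply q 0).symm
    rw [homogeneousComponent_zero, C_eq_zero] at h0
    rw [MvPolynomial.aeval_zero, ← h0]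
    simp [constantCoeff_eq]

/-- The endomorphism `[x] ↦ [F_0(x) : ⋯ : F_N(x)]` of the scheme `ℙ^N`. -/
def endOfForms {N d : ℕ} (hd : 0 < d) (F : FormTuple N d) (hF : NoCommonZero F) :
    ProjSpace N ⟶ ProjSpace N :=
  (substHom hd F hF).projMap

/-- The set `Hom_d(ℙ^N)` of endomorphisms of `ℙ^N` of algebraic degree `d`: `(N + 1)`-tuples of
forms of degree `d` without common zeros, up to a common scalar. -/
def HomSpace (N d : ℕ) : Type := {F : ℙ ℂ (FormTuple N d) // NoCommonZero F.rep}

/-- The coefficients of a tuple of forms of degree `d`, indexed by the form and by the monomial. -/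
def coeffMap (N d : ℕ) :
    FormTuple N d →ₗ[ℂ] (Fin (N + 1) × {m : Fin (N + 1) →₀ ℕ // m.degree = d} → ℂ) where
  toFun F k := MvPolynomial.coeff k.2.1 (F k.1 : MvPolynomial (Fin (N + 1)) ℂ)
  map_add' _ _ := by funext k; simp
  map_smul' _ _ := by funext k; simp

lemma coeffMap_injective (N d : ℕ) : Function.Injective (coeffMap N d) := by
  intro F G h
  funext i
  apply Subtype.ext
  ext m
  by_cases hm : m.degree = d
  · exact congrFun h (i, ⟨m, hm⟩)
  · rw [IsHomogeneous.coeff_eq_zero (F i).2 hm, IsHomogeneous.coeff_eq_zero (G i).2 hm]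

namespace HomSpace

variable {N d : ℕ}

/-- The injection `Hom_d(ℙ^N) ↪ ℙ^{N'-1}(ℂ)`, `N' = (N + 1) * (N + d).choose d`, given by the
coefficients. -/
def coeffPoint (f : HomSpace N d) :
    ℙ ℂ (Fin (N + 1) × {m : Fin (N + 1) →₀ ℕ // m.degree = d} → ℂ) :=
  Projectivization.map (coeffMap N d) (coeffMap_injective N d) f.1

/-- The Zariski topology of `Hom_d(ℙ^N)`, as a subspace of the closed points of `ℙ^{N'-1}`. -/
instance : TopologicalSpace (HomSpace N d) :=
  TopologicalSpace.induced (fun f => closedPoint f.coeffPoint) inferInstance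

/-- The endomorphism of the scheme `ℙ^N` that an element of `Hom_d(ℙ^N)` stands for. -/
def toHom (hd : 0 < d) (f : HomSpace N d) : ProjSpace N ⟶ ProjSpace N :=
  endOfForms hd f.1.rep f.2

end HomSpace

/-- `e(f) = max e_f(x)` over `x ∈ ℙ^N(ℂ)`. -/
def maxMultiplicity {N : ℕ} (f : ProjSpace N ⟶ ProjSpace N) : ℕ∞ :=
  ⨆ x : ℙ ℂ (Fin (N + 1) → ℂ), multiplicity f (complexPoint x)

end GenEnd

end

open MvPolynomial

attribute [local instance] MvPolynomial.gradedAlgebra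

/-! The argument is a dimension count. It gives the bound `2 ^ N`; the factor `N!` enters only
through a trivial inequality.

Move both `x` and `f(x)` to `e₀ = [1:0:…:0]` by linear coordinate changes. In affine coordinates the
germ becomes `N` power series without constant term, and the multiplicity is the colength of the
ideal they generate. Call a germ good if this ideal and the `2 ^ N` squarefree monomials span
everything modulo terms of order at least `M` (`SquarefreeSpans`). For `M > 2 ^ N`, Nakayama's lemma
removes the truncation and a good germ has multiplicity at most `2 ^ N`
(`length_quotient_le_of_squarefreeSpans`).

Tuples that map `e₀` to `e₀` with a germ that is not good form a cone, cut out by the vanishing of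
`N` coefficients and of minors of a coefficient matrix. For `d ≥ 2` there is a linear space of
tuples of dimension `2 * N + 1` that meets this cone in `0` only: `N` free constants together with
the `N + 1` parameters of `quadraticSystem`, of which every nonzero member is good
(`sq_mem_of_quadraticSystem`). Hence the cone has codimension at least `2 * N + 1`. The pairs of
source and target points depend on only `2 * N` parameters, so the translates of the cone are not
dense and lie in a hypersurface, whose complement is the required open set.

The count is made algebraic by Noether normalization: the linear forms that cut out the test space
make the coordinate ring of the cone integral over few generators, so too many functions on it
satisfy a polynomial relation (`exists_ne_zero_vanishing_on_family`). The same elimination with `N`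
parameters shows that a general tuple has no common zero, which gives density. For `d = 1` every
germ is a linear isomorphism and no genericity is needed. -/

/-! ### Noether normalization of cones and elimination of parameters -/

lemma IsIntegral.map_adjoin {k A B : Type} [Field k] [CommRing A] [CommRing B] [Algebra k A]
    [Algebra k B] (f : A →ₐ[k] B) {s : Set A} {t : Set B} (h : ∀ a ∈ s, f a ∈ t) {x : A}
    (hx : IsIntegral (Algebra.adjoin k s) x) : IsIntegral (Algebra.adjoin k t) (f x) := by
  obtain ⟨p, hp, h0⟩ := hx
  have hle : (Algebra.adjoin k s).map f ≤ Algebra.adjoin k t := by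
    rw [AlgHom.map_adjoin]
    exact Algebra.adjoin_mono (by rintro _ ⟨a, ha, rfl⟩; exact h a ha)
  let φ : Algebra.adjoin k s →+* Algebra.adjoin k t :=
    ((f : A →+* B).comp (Algebra.adjoin k s).val.toRingHom).codRestrict _
      (fun x => hle ⟨x, x.2, rfl⟩)
  refine ⟨p.map φ, hp.map φ, ?_⟩
  rw [Polynomial.eval₂_map]
  have := congrArg f h0
  rw [map_zero, ← AlgHom.coe_toRingHom, Polynomial.hom_eval₂] at this
  exact this

/-- In an algebra that is integral over a subalgebra generated by fewer than `card ι` elements,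
every family indexed by `ι` satisfies a polynomial relation. -/
theorem exists_aeval_eq_zero_of_isIntegral {k R κ ι : Type} [Field k] [CommRing R] [Algebra k R]
    [Fintype κ] [Fintype ι] (z : κ → R)
    (hint : ∀ r : R, IsIntegral (Algebra.adjoin k (Set.range z)) r) (w : ι → R)
    (hcard : Fintype.card κ < Fintype.card ι) :
    ∃ P : MvPolynomial ι k, P ≠ 0 ∧ aeval w P = 0 := by
  by_contra! H
  -- `R` need not be a domain. If the family had no relation, the nonzero polynomials in it would
  -- avoid `0`, so some prime `p` avoids them all. The family stays algebraically independent in the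
  -- domain `R ⧸ p`, where transcendence degrees can be compared.
  let S : Submonoid R := (nonZeroDivisors (MvPolynomial ι k)).map (aeval w)
  have hS : Disjoint ((⊥ : Ideal R) : Set R) S := by
    rw [Set.disjoint_left]
    rintro x hx ⟨P, hP, rfl⟩
    exact H P (nonZeroDivisors.ne_zero hP) hx
  obtain ⟨p, hp, -, hpS⟩ := Ideal.exists_le_prime_disjoint ⊥ S hS
  let π := Ideal.Quotient.mkₐ k p
  have hw : AlgebraicIndependent k (fun i => π (w i)) := by
    rw [algebraicIndependent_iff]
    intro P hP
    by_contra hP0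
    have h1 : aeval (fun i => π (w i)) P = π (aeval w P) := by
      rw [← comp_aeval_apply]
    rw [h1] at hP
    exact Set.disjoint_left.1 hpS (Ideal.Quotient.eq_zero_iff_mem.1 hP)
      ⟨P, mem_nonZeroDivisors_of_ne_zero hP0, rfl⟩
  have hfrac : Algebra.IsAlgebraic (Algebra.adjoin k (Set.range fun i => π (z i))) (R ⧸ p) := by
    refine ⟨fun x => ?_⟩
    obtain ⟨r, rfl⟩ := Ideal.Quotient.mk_surjective x
    refine ((hint r).map_adjoin π ?_).isAlgebraic
    rintro _ ⟨i, rfl⟩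
    exact ⟨i, rfl⟩
  have h1 := hw.cardinalMk_le_trdeg
  have h2 := Algebra.IsAlgebraic.trdeg_le_cardinalMk k (A := R ⧸ p) (s := Set.range fun i => π (z i))
  have h3 := Cardinal.mk_range_le (f := fun i => π (z i))
  have := h1.trans (h2.trans h3)
  simp only [Cardinal.mk_fintype, Nat.cast_le] at this
  omega

lemma homogeneousComponent_succ_mul {σ R : Type} [CommRing R] {a b : MvPolynomial σ R}
    (hb : b.IsHomogeneous 1) (n : ℕ) :
    homogeneousComponent (n + 1) (a * b) = homogeneousComponent n a * b := by
  have h := DirectSum.coe_decompose_mul_of_right_mem_of_le (homogeneousSubmodule σ R) (a := a)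
    (b := b) (n := n + 1) (i := 1) hb (by omega)
  have e : ∀ (p : MvPolynomial σ R) (i : ℕ),
      (DirectSum.decompose (homogeneousSubmodule σ R) p i : MvPolynomial σ R) =
        homogeneousComponent i p := fun p i => decomposition.decompose'_apply p i
  rwa [e, e] at h

/-- Linear forms whose only common zero on a cone is the vertex form a Noether normalization of
the coordinate ring of the cone. -/
theorem isIntegral_adjoin_linear_of_zeroLocus {k I κ : Type} [Field k] [IsAlgClosed k] [Finite I]
    [Fintype κ] (𝒢 : Set (MvPolynomial I k)) (h𝒢 : ∀ g ∈ 𝒢, ∃ n, g.IsHomogeneous n)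
    (ℓ : κ → MvPolynomial I k) (hℓ : ∀ j, (ℓ j).IsHomogeneous 1)
    (hzero : ∀ y : I → k, (∀ g ∈ 𝒢, eval y g = 0) → (∀ j, eval y (ℓ j) = 0) → y = 0)
    (r : MvPolynomial I k ⧸ Ideal.span 𝒢) :
    IsIntegral (Algebra.adjoin k (Set.range fun j => Ideal.Quotient.mk (Ideal.span 𝒢) (ℓ j))) r := by
  set π := Ideal.Quotient.mk (Ideal.span 𝒢)
  set A := Algebra.adjoin k (Set.range fun j => π (ℓ j))
  let J : Ideal (MvPolynomial I k) := Ideal.span 𝒢 ⊔ Ideal.span (Set.range ℓ)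
  -- By the Nullstellensatz, `J` is primary to the vertex and so contains all monomials of degree at
  -- least some `D`. The monomials of degree at most `D` will generate the quotient as an
  -- `A`-module.
  have hrad : idealOfVars I k ≤ J.radical := by
    rw [← vanishingIdeal_zeroLocus_eq_radical (K := k), Ideal.span_le]
    rintro _ ⟨i, rfl⟩
    rw [SetLike.mem_coe, mem_vanishingIdeal_iff]
    intro y hy
    have hy' := fun p hp => (mem_zeroLocus_iff.1 hy) p hp
    have : y = 0 := hzero y (fun g hg => hy' g (Ideal.mem_sup_left (Ideal.subset_span hg)))
      (fun j => hy' _ (Ideal.mem_sup_right (Ideal.subset_span ⟨j, rfl⟩)))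
    simp [this]
  obtain ⟨D, hD⟩ := Ideal.exists_pow_le_of_le_radical_of_fg hrad (idealOfVars_fg I k)
  have hhom : (Ideal.span 𝒢).IsHomogeneous (homogeneousSubmodule I k) :=
    Ideal.homogeneous_span _ _ fun g hg => h𝒢 g hg
  let T : Set (MvPolynomial I k ⧸ Ideal.span 𝒢) :=
    (fun m : I →₀ ℕ => π (monomial m 1)) '' {m | m.degree ≤ D}
  have hT : T.Finite := (Finsupp.finite_of_degree_le D).image _
  let W := Submodule.span A T
  have hsum : ∀ p : MvPolynomial I k, (∀ m ∈ p.support, π (monomial m 1) ∈ W) → π p ∈ W := by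
    intro p hp
    rw [← support_sum_monomial_coeff p, map_sum]
    refine W.sum_mem fun m hm => ?_
    rw [← mul_one (coeff m p), ← C_mul_monomial, map_mul]
    exact W.smul_mem (⟨π (C (coeff m p)), A.algebraMap_mem (coeff m p)⟩ : A) (hp m hm)
  have key : ∀ n, ∀ m : I →₀ ℕ, m.degree = n → π (monomial m 1) ∈ W := by
    intro n
    induction n with
    | zero => exact fun m hm => Submodule.subset_span ⟨m, by simp [hm], rfl⟩
    | succ n ih =>
      intro m hm
      by_cases hmD : m.degree ≤ D
      · exact Submodule.subset_span ⟨m, hmD, rfl⟩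
      have hmem : (monomial m (1 : k)) ∈ J := by
        apply hD
        rw [mem_pow_idealOfVars_iff]
        intro x hx
        have := support_monomial_subset hx
        rw [Finset.mem_singleton] at this
        subst this
        omega
      obtain ⟨a, ha, b, hb, hab⟩ := Submodule.mem_sup.1 hmem
      obtain ⟨c, rfl⟩ := Ideal.mem_span_range_iff_exists_fun.1 hb
      -- Only the part of degree `n + 1` matters. Since the `ℓ j` are linear, their cofactors may be
      -- cut down to degree `n`, where induction applies.
      have hcomp := congrArg (homogeneousComponent (n + 1)) hab
      rw [homogeneousComponent_of_mem (m := n + 1) (n := n + 1) (isHomogeneous_monomial 1 hm),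
        if_pos rfl, map_add, map_sum] at hcomp
      simp only [homogeneousComponent_succ_mul (hℓ _)] at hcomp
      rw [← hcomp, map_add, map_sum]
      refine W.add_mem ?_ (W.sum_mem fun j _ => ?_)
      · rw [Ideal.Quotient.eq_zero_iff_mem.2 (homogeneousComponent_mem_of_mem hhom ha _)]
        exact W.zero_mem
      · rw [map_mul, mul_comm]
        refine W.smul_mem (⟨π (ℓ j), Algebra.subset_adjoin ⟨j, rfl⟩⟩ : A) (hsum _ fun m' hm' => ?_)
        apply ih
        by_contra hne
        rw [mem_support_iff, coeff_homogeneousComponent, if_neg hne] at hm'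
        exact hm' rfl
  have htop : W = ⊤ := by
    rw [eq_top_iff]
    rintro x -
    obtain ⟨p, rfl⟩ := Ideal.Quotient.mk_surjective x
    exact hsum p fun m _ => key _ m rfl
  have : Module.Finite A (MvPolynomial I k ⧸ Ideal.span 𝒢) := ⟨⟨hT.toFinset, by simpa using htop⟩⟩
  exact Algebra.IsIntegral.isIntegral r

/-- Let a cone be cut out by `𝒢` and meet a linear space of dimension `card E` in the vertex only.
Then the images of the cone under a polynomial family of maps with fewer than `card E` parameters
are not dense. -/
theorem exists_ne_zero_vanishing_on_family {k I E T : Type} [Field k] [IsAlgClosed k] [Fintype I]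
    [Fintype E] [Fintype T] (𝒢 : Set (MvPolynomial I k)) (h𝒢 : ∀ g ∈ 𝒢, ∃ n, g.IsHomogeneous n)
    (h0 : ∀ g ∈ 𝒢, eval 0 g = 0) (L : (E → k) →ₗ[k] (I → k))
    (hL : ∀ z, (∀ g ∈ 𝒢, eval (L z) g = 0) → z = 0)
    (w : I → MvPolynomial (T ⊕ I) k) (hcard : Fintype.card T < Fintype.card E) :
    ∃ P : MvPolynomial I k, P ≠ 0 ∧ ∀ (t : T → k) (y : I → k), (∀ g ∈ 𝒢, eval y g = 0) →
      eval (fun i => eval (Sum.elim t y) (w i)) P = 0 := by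
  classical
  have hinj : Function.Injective L := by
    rw [injective_iff_map_eq_zero]
    exact fun z hz => hL z (by rwa [hz])
  let V := LinearMap.range L
  have hV : Module.finrank k V = Fintype.card E := by
    rw [LinearMap.finrank_range_of_inj hinj, Module.finrank_fintype_fun_eq_card]
  have hann := V.finrank_quotient_add_finrank
  rw [hV, Module.finrank_fintype_fun_eq_card] at hann
  -- The range of `L` is cut out by `card I - card E` linear forms.
  let b := Module.finBasis k ((I → k) ⧸ V)
  let φ : Fin (Module.finrank k ((I → k) ⧸ V)) → (I → k) →ₗ[k] k := fun j => b.coord j ∘ₗ V.mkQ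
  let ℓ : Fin (Module.finrank k ((I → k) ⧸ V)) → MvPolynomial I k :=
    fun j => ∑ i, C (φ j (Pi.single i 1)) * X i
  have hℓ : ∀ j, (ℓ j).IsHomogeneous 1 := fun j =>
    IsHomogeneous.sum _ _ _ fun i _ => isHomogeneous_C_mul_X _ _
  have hℓe : ∀ j y, eval y (ℓ j) = φ j y := by
    intro j y
    conv_rhs => rw [← Finset.univ_sum_single y, map_sum]
    simp only [ℓ, map_sum, map_mul, eval_C, eval_X]
    refine Finset.sum_congr rfl fun i _ => ?_
    rw [mul_comm, ← smul_eq_mul, ← map_smul, ← Pi.single_smul, smul_eq_mul, mul_one]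
  have hzero : ∀ y : I → k, (∀ g ∈ 𝒢, eval y g = 0) → (∀ j, eval y (ℓ j) = 0) → y = 0 := by
    intro y hy hj
    have hyV : y ∈ V := by
      rw [← V.ker_mkQ, LinearMap.mem_ker, ← b.forall_coord_eq_zero_iff]
      exact fun j => (hℓe j y).symm.trans (hj j)
    obtain ⟨z, rfl⟩ := hyV
    rw [hL z hy, map_zero]
  have hint := isIntegral_adjoin_linear_of_zeroLocus 𝒢 h𝒢 ℓ hℓ hzero
  let K : Ideal (MvPolynomial (T ⊕ I) k) := Ideal.span (rename Sum.inr '' 𝒢)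
  let π := Ideal.Quotient.mkₐ k K
  let ρ : (MvPolynomial I k ⧸ Ideal.span 𝒢) →ₐ[k] (MvPolynomial (T ⊕ I) k ⧸ K) :=
    Ideal.Quotient.liftₐ (Ideal.span 𝒢) (π.comp (rename Sum.inr)) fun a ha => by
      have hle : Ideal.span 𝒢 ≤ RingHom.ker (π.comp (rename Sum.inr)) := by
        rw [Ideal.span_le]
        intro g hg
        exact Ideal.Quotient.eq_zero_iff_mem.2 (Ideal.subset_span ⟨g, hg, rfl⟩)
      exact hle ha
  -- Parameters and linear forms together number `card T + card I - card E`, which is less than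
  -- `card I`; the family `w` therefore has a relation.
  let z : T ⊕ Fin (Module.finrank k ((I → k) ⧸ V)) → MvPolynomial (T ⊕ I) k ⧸ K :=
    Sum.elim (fun t => π (X (Sum.inl t))) fun j => π (rename Sum.inr (ℓ j))
  have hz : ∀ r : MvPolynomial (T ⊕ I) k ⧸ K, IsIntegral (Algebra.adjoin k (Set.range z)) r := by
    intro r
    obtain ⟨p, rfl⟩ := Ideal.Quotient.mk_surjective r
    change IsIntegral _ (π p)
    induction p using MvPolynomial.induction_on with
    | C c => exact isIntegral_algebraMap (x := (algebraMap k (Algebra.adjoin k (Set.range z)) c))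
    | add p q hp hq => rw [map_add]; exact hp.add hq
    | mul_X p i hp =>
      rw [map_mul]
      refine hp.mul ?_
      rcases i with t | i
      · exact isIntegral_algebraMap
          (x := (⟨_, Algebra.subset_adjoin ⟨Sum.inl t, rfl⟩⟩ : Algebra.adjoin k (Set.range z)))
      · have h := (hint (Ideal.Quotient.mk _ (X i))).map_adjoin ρ (t := Set.range z)
          (by rintro _ ⟨j, rfl⟩; exact ⟨Sum.inr j, rfl⟩)
        have e : ρ (Ideal.Quotient.mk _ (X i)) = π (rename Sum.inr (X i)) := rfl
        rwa [e, rename_X] at h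
  obtain ⟨P, hP, hP0⟩ := exists_aeval_eq_zero_of_isIntegral z hz (fun i => π (w i))
    (by rw [Fintype.card_sum, Fintype.card_fin]; omega)
  refine ⟨P, hP, fun t y hy => ?_⟩
  let ev : (MvPolynomial (T ⊕ I) k ⧸ K) →ₐ[k] k :=
    Ideal.Quotient.liftₐ K (aeval (Sum.elim t y)) fun a ha => by
      have hle : K ≤ RingHom.ker (aeval (Sum.elim t y) : MvPolynomial (T ⊕ I) k →ₐ[k] k) := by
        rw [Ideal.span_le]
        rintro _ ⟨g, hg, rfl⟩
        rw [SetLike.mem_coe, RingHom.mem_ker, aeval_rename, Sum.elim_comp_inr]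
        exact hy g hg
      exact hle ha
  have h := congrArg ev hP0
  rw [map_zero, ← AlgHom.comp_apply, comp_aeval] at h
  exact h

/-! ### Squarefree spanning and the quadratic test systems -/

/-- The polynomials `f` together with the squarefree monomials span all polynomials modulo terms
of degree at least `M`. -/
def SquarefreeSpans {N : ℕ} (f : Fin N → MvPolynomial (Fin N) ℂ) (M : ℕ) : Prop :=
  (Submodule.span ℂ (Set.range fun s : Finset (Fin N) => ∏ i ∈ s, X i)) ⊔
    (Ideal.span (Set.range f) ⊔ idealOfVars (Fin N) ℂ ^ M).restrictScalars ℂ = ⊤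

lemma monomial_eq_prod_X {N : ℕ} (m : Fin N →₀ ℕ) (hm : ∀ i, m i < 2) :
    monomial m (1 : ℂ) = ∏ i ∈ m.support, X i := by
  rw [monomial_eq, C_1, one_mul, Finsupp.prod]
  refine Finset.prod_congr rfl fun i hi => ?_
  have := hm i
  have h1 := Finsupp.mem_support_iff.1 hi
  rw [show m i = 1 by omega, pow_one]

/-- A monomial that is not squarefree is divisible by some `X i ^ 2`. Modulo the ideal of `f` this
square may be replaced by terms of order 3, which raises the degree; after finitely many
replacements only squarefree monomials and terms of degree at least `M` are left. -/
theorem squarefreeSpans_of_sq_mem {N : ℕ} {f : Fin N → MvPolynomial (Fin N) ℂ}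
    (hf : ∀ i, X i ^ 2 ∈ Ideal.span (Set.range f) ⊔ idealOfVars (Fin N) ℂ ^ 3) (M : ℕ) :
    SquarefreeSpans f M := by
  set I := Ideal.span (Set.range f)
  set T := Submodule.span ℂ (Set.range fun s : Finset (Fin N) =>
    (∏ i ∈ s, X i : MvPolynomial (Fin N) ℂ))
  set W := T ⊔ (I ⊔ idealOfVars (Fin N) ℂ ^ M).restrictScalars ℂ with hW
  have hI : ∀ p ∈ I, p ∈ W := fun p hp => Submodule.mem_sup_right (Ideal.mem_sup_left hp)
  have hsum : ∀ p : MvPolynomial (Fin N) ℂ, (∀ m ∈ p.support, monomial m (1 : ℂ) ∈ W) → p ∈ W := by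
    intro p hp
    rw [← support_sum_monomial_coeff p]
    refine W.sum_mem fun m hm => ?_
    rw [← mul_one (coeff m p), ← smul_eq_mul, ← smul_monomial]
    exact W.smul_mem _ (hp m hm)
  -- Descending induction on the degree: `n` bounds how far the degree is below `M`.
  have key : ∀ n, ∀ m : Fin N →₀ ℕ, M ≤ m.degree + n → monomial m (1 : ℂ) ∈ W := by
    intro n
    induction n with
    | zero =>
      intro m hm
      refine Submodule.mem_sup_right (Ideal.mem_sup_right ?_)
      change monomial m (1 : ℂ) ∈ idealOfVars (Fin N) ℂ ^ M
      rw [mem_pow_idealOfVars_iff]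
      intro x hx
      have := support_monomial_subset hx
      rw [Finset.mem_singleton] at this
      subst this
      exact hm
    | succ n ih =>
      intro m hm
      by_cases hsq : ∀ i, m i < 2
      · rw [monomial_eq_prod_X m hsq]
        exact Submodule.mem_sup_left (Submodule.subset_span ⟨_, rfl⟩)
      push Not at hsq
      obtain ⟨i, hi⟩ := hsq
      obtain ⟨a, ha, b, hb, hab⟩ := Submodule.mem_sup.1 (hf i)
      have hle : Finsupp.single i 2 ≤ m := by simpa using hi
      obtain ⟨m', rfl⟩ := exists_add_of_le hle
      have e : monomial (Finsupp.single i 2 + m') (1 : ℂ) =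
          monomial m' 1 * a + monomial m' 1 * b := by
        rw [← mul_add, hab, X_pow_eq_monomial, monomial_mul, add_comm, one_mul]
      rw [e]
      refine W.add_mem (hI _ (I.mul_mem_left _ ha)) (hsum _ fun x hx => ih _ ?_)
      have hb' := (mem_pow_idealOfVars_iff (R := ℂ) (m'.degree + 3) (monomial m' 1 * b)).1
        (by
          rw [pow_add]
          refine Ideal.mul_mem_mul ?_ hb
          rw [mem_pow_idealOfVars_iff]
          intro y hy
          have := support_monomial_subset hy
          rw [Finset.mem_singleton] at this
          subst this
          exact le_rfl) x hx
      have hdeg : (Finsupp.single i 2 + m').degree = 2 + m'.degree := by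
        rw [map_add, Finsupp.degree_single]
      omega
  rw [SquarefreeSpans, ← hW, eq_top_iff]
  exact fun p _ => hsum p fun m _ => key M m (by omega)

/-- The extension by zero of a sequence `c_0, …, c_N`. -/
noncomputable def extendByZero {N : ℕ} (c : Fin (N + 1) → ℂ) (n : ℤ) : ℂ :=
  if h : 0 ≤ n ∧ n ≤ N then c ⟨n.toNat, by omega⟩ else 0

/-- A system of `N` polynomials with terms of degree `1` and `2` only, which depends linearly on
`N + 1` parameters. -/
noncomputable def quadraticSystem {N : ℕ} (c : Fin (N + 1) → ℂ) (s : Fin N) : MvPolynomial (Fin N) ℂ :=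
  ∑ i : Fin N, (C (extendByZero c (s - i)) * X i + C (extendByZero c (s - i + N)) * X i ^ 2)

/-- Let `k` be the first index with `c k ≠ 0`. The coefficients form a band that is triangular along
the index `k`: its linear part yields `X i` modulo order 2 when `i + k < N`, and its quadratic part
yields `X i ^ 2` modulo order 3 for the remaining `i`. Each variable is treated by one of the two,
whatever `k` is. -/
theorem sq_mem_of_quadraticSystem {N : ℕ} {c : Fin (N + 1) → ℂ} (hc : c ≠ 0) (i : Fin N) :
    X i ^ 2 ∈ Ideal.span (Set.range (quadraticSystem c)) ⊔ idealOfVars (Fin N) ℂ ^ 3 := by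
  classical
  obtain ⟨k, hk, hmin⟩ : ∃ k : ℕ, extendByZero c k ≠ 0 ∧ ∀ n : ℤ, n < k → extendByZero c n = 0 := by
    have hex : ∃ k : ℕ, extendByZero c k ≠ 0 := by
      obtain ⟨j, hj⟩ := Function.ne_iff.1 hc
      refine ⟨j, ?_⟩
      rw [extendByZero, dif_pos ⟨by omega, by omega⟩]
      simpa using hj
    refine ⟨Nat.find hex, Nat.find_spec hex, fun n hn => ?_⟩
    by_cases h0 : 0 ≤ n
    · lift n to ℕ using h0
      exact not_not.1 (Nat.find_min hex (by exact_mod_cast hn))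
    · rw [extendByZero, dif_neg (by omega)]
  have hkN : k ≤ N := by
    by_contra h
    apply hk
    rw [extendByZero, dif_neg (by omega)]
  set I := Ideal.span (Set.range (quadraticSystem c))
  set m := idealOfVars (Fin N) ℂ
  have hX : ∀ i, (X i : MvPolynomial (Fin N) ℂ) ∈ m := fun i => Ideal.subset_span ⟨i, rfl⟩
  have hmem : ∀ (J : Ideal (MvPolynomial (Fin N) ℂ)) (i : Fin N) (a : Fin N → ℂ)
      (Y : Fin N → MvPolynomial (Fin N) ℂ), a i ≠ 0 → (∑ j, C (a j) * Y j) ∈ J →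
      (∀ j, j ≠ i → C (a j) * Y j ∈ J) → Y i ∈ J := by
    intro J i a Y ha hs hj
    rw [← Finset.add_sum_erase _ _ (Finset.mem_univ i)] at hs
    have h1 := (J.add_mem_iff_left (J.sum_mem fun j hj' => hj j (Finset.ne_of_mem_erase hj'))).1 hs
    have h2 := J.mul_mem_left (C (a i)⁻¹) h1
    rwa [← mul_assoc, ← C_mul, inv_mul_cancel₀ ha, C_1, one_mul] at h2
  have hlin : ∀ n : ℕ, ∀ i : Fin N, (i : ℕ) = n → (i : ℕ) + k < N → X i ∈ I ⊔ m ^ 2 := by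
    intro n
    induction n using Nat.strong_induction_on with
    | _ n ih =>
      intro i hin hi
      -- In this equation `X i` has coefficient `c k`; for `j > i` the coefficient has index below
      -- `k` and vanishes, and `j < i` is covered by induction.
      let s : Fin N := ⟨i + k, hi⟩
      refine hmem _ i (fun j => extendByZero c (s - j)) X ?_ ?_ ?_
      · simpa [s] using hk
      · have h1 : quadraticSystem c s ∈ I ⊔ m ^ 2 :=
          Ideal.mem_sup_left (Ideal.subset_span ⟨s, rfl⟩)
        rw [quadraticSystem, Finset.sum_add_distrib] at h1
        refine ((I ⊔ m ^ 2).add_mem_iff_left ?_).1 h1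
        exact Ideal.sum_mem _ fun j _ => Ideal.mul_mem_left _ _
          (Ideal.mem_sup_right (Ideal.pow_mem_pow (hX j) 2))
      · intro j hj
        rcases lt_or_gt_of_ne (fun h : (j : ℕ) = i => hj (Fin.ext h)) with h | h
        · exact Ideal.mul_mem_left _ _ (ih j (by omega) j rfl (by omega))
        · rw [hmin _ (by simp only [s]; omega)]
          simp
  have hsq : ∀ n : ℕ, ∀ i : Fin N, (i : ℕ) = n → X i ^ 2 ∈ I ⊔ m ^ 3 := by
    intro n
    induction n using Nat.strong_induction_on with
    | _ n ih =>
      intro i hin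
      by_cases hi : (i : ℕ) + k < N
      · obtain ⟨a, ha, b, hb, hab⟩ := Submodule.mem_sup.1 (hlin i i rfl hi)
        rw [pow_two]
        nth_rewrite 2 [← hab]
        rw [mul_add]
        refine Ideal.add_mem _ (Ideal.mem_sup_left (I.mul_mem_left _ ha))
          (Ideal.mem_sup_right ?_)
        rw [pow_succ']
        exact Ideal.mul_mem_mul (hX i) hb
      -- Here all linear coefficients have index `s - j ≤ i + k - N < k` and vanish, while `X i ^ 2`
      -- has coefficient `c k`.
      · let s : Fin N := ⟨i + k - N, by omega⟩
        have hs : ((s : ℕ) : ℤ) = i + k - N := by simp only [s]; omega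
        refine hmem _ i (fun j => extendByZero c (s - j + N)) (fun j => X j ^ 2) ?_ ?_ ?_
        · rw [hs]
          ring_nf
          exact hk
        · have h1 : quadraticSystem c s ∈ I ⊔ m ^ 3 :=
            Ideal.mem_sup_left (Ideal.subset_span ⟨s, rfl⟩)
          rw [quadraticSystem, Finset.sum_add_distrib] at h1
          refine ((I ⊔ m ^ 3).add_mem_iff_right ?_).1 h1
          refine Ideal.sum_mem _ fun j _ => ?_
          rw [hmin _ (by omega)]
          simp
        · intro j hj
          rcases lt_or_gt_of_ne (fun h : (j : ℕ) = i => hj (Fin.ext h)) with h | h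
          · exact Ideal.mul_mem_left _ _ (ih j (by omega) j rfl)
          · rw [hmin _ (by omega)]
            simp
  exact hsq i i rfl

/-! ### Squarefree spanning as a rank condition -/

/-- The exponents of the non-squarefree monomials of degree less than `M`. -/
abbrev NonSquarefree (N M : ℕ) : Type := {m : Fin N →₀ ℕ // m.degree < M ∧ ∃ i, 2 ≤ m i}

instance (N M : ℕ) : Finite (NonSquarefree N M) :=
  Set.Finite.to_subtype ((Finsupp.finite_of_degree_le M).subset fun _ h => h.1.le)

noncomputable instance (N M : ℕ) : Fintype (NonSquarefree N M) := Fintype.ofFinite _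

/-- Turns full rank of a possibly infinite family of vectors into the nonvanishing of a maximal
minor, so that its failure is a system of polynomial equations. -/
theorem exists_det_ne_zero_iff_span_eq_top {A K : Type} [Fintype K] [DecidableEq K]
    (u : A → K → ℂ) :
    (∃ σ : K → A, (Matrix.of fun k l => u (σ k) l).det ≠ 0) ↔
      Submodule.span ℂ (Set.range u) = ⊤ := by
  constructor
  · rintro ⟨σ, hσ⟩
    have h := (Matrix.linearIndependent_rows_iff_isUnit (K := ℂ)).2
      ((Matrix.isUnit_iff_isUnit_det _).2 (isUnit_iff_ne_zero.2 hσ))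
    have h2 := h.span_eq_top_of_card_eq_finrank' (by simp)
    rw [eq_top_iff, ← h2]
    refine Submodule.span_mono ?_
    rintro _ ⟨k, rfl⟩
    exact ⟨σ k, rfl⟩
  · intro h
    obtain ⟨b, hb, hspan, hli⟩ := exists_linearIndependent ℂ (Set.range u)
    rw [h] at hspan
    let B : Module.Basis b ℂ (K → ℂ) := Module.Basis.mk hli (by simp [hspan])
    let e : K ≃ b := (Pi.basisFun ℂ K).indexEquiv B
    choose σ hσ using fun x : b => hb x.2
    refine ⟨fun k => σ (e k), ?_⟩
    have h2 : LinearIndependent ℂ fun k => ((e k : K → ℂ)) := hli.comp e e.injective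
    have h3 := (Matrix.linearIndependent_rows_iff_isUnit (K := ℂ)
      (A := Matrix.of fun k l => u (σ (e k)) l)).1 (by
        have e1 : (Matrix.of fun k l => u (σ (e k)) l).row = fun k => (e k : K → ℂ) :=
          funext fun k => hσ (e k)
        rw [e1]
        exact h2)
    exact ((Matrix.isUnit_iff_isUnit_det _).1 h3).ne_zero

/-- Taking the coefficients at `NonSquarefree N M` is a surjection whose kernel is spanned by the
squarefree monomials and the terms of degree at least `M`. The spanning condition thus says that the
ideal of `f`, spanned over `ℂ` by monomial multiples of `f`, surjects onto the target. -/
theorem squarefreeSpans_iff_span_eq_top {N : ℕ} (f : Fin N → MvPolynomial (Fin N) ℂ) (M : ℕ) :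
    SquarefreeSpans f M ↔ Submodule.span ℂ (Set.range fun (a : (Fin N →₀ ℕ) × Fin N)
      (m : NonSquarefree N M) => coeff m.1 (monomial a.1 1 * f a.2)) = ⊤ := by
  classical
  let π : MvPolynomial (Fin N) ℂ →ₗ[ℂ] (NonSquarefree N M → ℂ) :=
    LinearMap.pi fun m => lcoeff ℂ m.1
  have hπ : ∀ p m, π p m = coeff m.1 p := fun p m => rfl
  have hsurj : LinearMap.range π = ⊤ := by
    rw [eq_top_iff, ← (Pi.basisFun ℂ (NonSquarefree N M)).span_eq, Submodule.span_le]
    rintro _ ⟨m, rfl⟩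
    refine ⟨monomial m.1 1, funext fun m' => ?_⟩
    rw [hπ, coeff_monomial, Pi.basisFun_apply, Pi.single_apply]
    simp only [Subtype.ext_iff, eq_comm]
  let T := Submodule.span ℂ (Set.range fun s : Finset (Fin N) =>
    (∏ i ∈ s, X i : MvPolynomial (Fin N) ℂ))
  have hker : LinearMap.ker π = T ⊔ (idealOfVars (Fin N) ℂ ^ M).restrictScalars ℂ := by
    apply le_antisymm
    · intro p hp
      rw [← support_sum_monomial_coeff p]
      refine Submodule.sum_mem _ fun m hm => ?_
      rw [← mul_one (coeff m p), ← smul_eq_mul, ← smul_monomial]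
      refine Submodule.smul_mem _ _ ?_
      by_cases h1 : ∀ i, m i < 2
      · rw [monomial_eq_prod_X m h1]
        exact Submodule.mem_sup_left (Submodule.subset_span ⟨_, rfl⟩)
      push Not at h1
      refine Submodule.mem_sup_right ?_
      change monomial m (1 : ℂ) ∈ idealOfVars (Fin N) ℂ ^ M
      rw [mem_pow_idealOfVars_iff]
      intro x hx
      have := support_monomial_subset hx
      rw [Finset.mem_singleton] at this
      subst this
      by_contra h2
      rw [mem_support_iff] at hm
      exact hm (congrFun (LinearMap.mem_ker.1 hp) ⟨x, by omega, h1⟩)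
    · refine sup_le (Submodule.span_le.2 ?_) ?_
      · rintro _ ⟨s, rfl⟩
        refine LinearMap.mem_ker.2 (funext fun m => ?_)
        rw [hπ]
        obtain ⟨i, hi⟩ := m.2.2
        have e : (∏ i ∈ s, X i : MvPolynomial (Fin N) ℂ) =
            monomial (∑ i ∈ s, Finsupp.single i 1) 1 := by
          rw [monomial_sum_one]; rfl
        change coeff m.1 (∏ i ∈ s, X i : MvPolynomial (Fin N) ℂ) = 0
        rw [e, coeff_monomial, if_neg]
        intro h
        rw [← h, Finsupp.finsetSum_apply] at hi
        have : ∑ j ∈ s, (Finsupp.single j 1 : Fin N →₀ ℕ) i ≤ 1 := by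
          simp only [Finsupp.single_apply]
          rw [Finset.sum_ite_eq' s i]
          split_ifs <;> omega
        omega
      · intro p hp
        refine LinearMap.mem_ker.2 (funext fun m => ?_)
        exact (mem_pow_idealOfVars_iff' M p).1 hp _ m.2.1
  have hspan : (Ideal.span (Set.range f)).restrictScalars ℂ =
      Submodule.span ℂ (Set.range fun (a : (Fin N →₀ ℕ) × Fin N) => monomial a.1 (1 : ℂ) * f a.2) := by
    apply le_antisymm
    · intro p hp
      obtain ⟨c, rfl⟩ := Ideal.mem_span_range_iff_exists_fun.1
        (show p ∈ Ideal.span (Set.range f) from hp)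
      refine Submodule.sum_mem _ fun s _ => ?_
      rw [← support_sum_monomial_coeff (c s), Finset.sum_mul]
      refine Submodule.sum_mem _ fun m _ => ?_
      rw [← mul_one (coeff m (c s)), ← C_mul_monomial, mul_assoc, ← smul_eq_C_mul]
      exact Submodule.smul_mem _ _ (Submodule.subset_span ⟨(m, s), rfl⟩)
    · rw [Submodule.span_le]
      rintro _ ⟨a, rfl⟩
      exact Ideal.mul_mem_left _ _ (Ideal.subset_span ⟨a.2, rfl⟩)
  have e1 : T ⊔ (Ideal.span (Set.range f) ⊔ idealOfVars (Fin N) ℂ ^ M).restrictScalars ℂ =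
      (Ideal.span (Set.range f)).restrictScalars ℂ ⊔ LinearMap.ker π := by
    rw [hker, sup_left_comm]
    refine congrArg (T ⊔ ·) (Submodule.ext fun p => ?_)
    simp only [Submodule.restrictScalars_mem, Submodule.mem_sup]
  rw [SquarefreeSpans]
  change T ⊔ _ = ⊤ ↔ _
  rw [e1, hspan, ← Submodule.comap_map_eq, Submodule.map_span, ← Set.range_comp]
  change Submodule.comap π (Submodule.span ℂ _) = ⊤ ↔ _
  rw [← top_le_iff, ← Submodule.map_le_iff_le_comap, ← LinearMap.range_eq_map, hsurj, top_le_iff]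
  rfl

/-! ### Length bound in a local ring -/

/-- A strictly decreasing chain of `M` ideals above `J` forces `S ⧸ J` to have dimension at
least `M`. -/
lemma le_finrank_quotient_of_strict_chain {S : Type} [CommRing S] [Algebra ℂ S]
    (J : ℕ → Ideal S) (M : ℕ)
    (hJ : ∀ j < M, J (j + 1) < J j) [hfin : Module.Finite ℂ (S ⧸ J M)] :
    M ≤ Module.finrank ℂ (S ⧸ J M) := by
  have hle : ∀ j ≤ M, J M ≤ J j := by
    intro j hj
    induction hj using Nat.decreasingInduction with
    | of_succ k hk ih => exact ih.trans (hJ k hk).le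
    | self => exact le_rfl
  let W : ℕ → Submodule ℂ (S ⧸ J M) := fun j =>
    ((J j).map (Ideal.Quotient.mk (J M))).restrictScalars ℂ
  have hW : ∀ j < M, W (j + 1) < W j := by
    intro j hj
    refine lt_of_le_not_ge (fun x hx => Ideal.map_mono (hJ j hj).le hx) fun hge => ?_
    refine (hJ j hj).not_ge fun x hx => ?_
    have h1 : Ideal.Quotient.mk (J M) x ∈ (J (j + 1)).map (Ideal.Quotient.mk (J M)) :=
      hge (Ideal.mem_map_of_mem _ hx)
    exact (Ideal.mem_quotient_iff_mem (hle _ hj)).1 h1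
  have key : ∀ j ≤ M, M - j ≤ Module.finrank ℂ (W j) := by
    intro j hj
    induction hj using Nat.decreasingInduction with
    | of_succ k hk ih =>
      have := Submodule.finrank_lt_finrank_of_lt (hW k hk)
      omega
    | self => omega
  exact (key 0 (by omega)).trans (Submodule.finrank_le _)

section LocalLength

variable {N : ℕ} {S : Type} [CommRing S] [IsLocalRing S] [Algebra ℂ S] {t : Fin N → S}

/-- Taylor expansion: subtract the residue constant, write the remainder in terms of the generators
`t`, and expand its coefficients to one order less. -/
lemma exists_sub_aeval_mem_maximalIdeal_pow
    (hm : IsLocalRing.maximalIdeal S = Ideal.span (Set.range t))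
    (hres : ∀ s : S, ∃ c : ℂ, s - algebraMap ℂ S c ∈ IsLocalRing.maximalIdeal S) (n : ℕ) (s : S) :
    ∃ p : MvPolynomial (Fin N) ℂ, s - aeval t p ∈ IsLocalRing.maximalIdeal S ^ n := by
  induction n generalizing s with
  | zero => exact ⟨0, by simp⟩
  | succ n ih =>
    obtain ⟨c, hc⟩ := hres s
    rw [hm] at hc
    obtain ⟨a, ha⟩ := Ideal.mem_span_range_iff_exists_fun.1 hc
    choose p hp using fun i => ih (a i)
    refine ⟨C c + ∑ i, p i * X i, ?_⟩
    have e : s - aeval t (C c + ∑ i, p i * X i) = ∑ i, (a i - aeval t (p i)) * t i := by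
      simp only [map_add, map_sum, map_mul, aeval_X, aeval_C, sub_mul, Finset.sum_sub_distrib]
      rw [ha]; ring
    rw [e, pow_succ]
    refine Ideal.sum_mem _ fun i _ => Ideal.mul_mem_mul (hp i) ?_
    rw [hm]
    exact Ideal.subset_span ⟨i, rfl⟩

/-- The `2 ^ N` squarefree products of `t` span `S ⧸ J` whenever `J` contains `I ⊔ m ^ M`. This
bounds the dimension modulo `m ^ M`, and `2 ^ N < M` then forces `m ^ M ≤ I`. Only finite generation
of the maximal ideal is used, so `S` need not be Noetherian. -/
theorem length_quotient_le_of_squarefreeSpans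
    (hm : IsLocalRing.maximalIdeal S = Ideal.span (Set.range t))
    (hres : ∀ s : S, ∃ c : ℂ, s - algebraMap ℂ S c ∈ IsLocalRing.maximalIdeal S)
    {f : Fin N → MvPolynomial (Fin N) ℂ} {M : ℕ} (hf : SquarefreeSpans f M) (hM : 2 ^ N < M)
    (I : Ideal S) (hI : ∀ s, aeval t (f s) ∈ I) :
    Module.length S (S ⧸ I) ≤ ((2 ^ N : ℕ) : ℕ∞) := by
  let m := IsLocalRing.maximalIdeal S
  have hfm : ∀ p ∈ Ideal.span (Set.range f) ⊔ idealOfVars (Fin N) ℂ ^ M,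
      aeval t p ∈ I ⊔ m ^ M := by
    intro p hp
    have hle : (Ideal.span (Set.range f) ⊔ idealOfVars (Fin N) ℂ ^ M).map
        (aeval t : MvPolynomial (Fin N) ℂ →ₐ[ℂ] S) ≤ I ⊔ m ^ M := by
      rw [Ideal.map_sup, Ideal.map_pow, Ideal.map_span, Ideal.map_span]
      refine sup_le_sup (Ideal.span_le.2 ?_) (Ideal.pow_right_mono (Ideal.span_le.2 ?_) M)
      · rintro _ ⟨_, ⟨s, rfl⟩, rfl⟩
        exact hI s
      · rintro _ ⟨_, ⟨i, rfl⟩, rfl⟩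
        rw [aeval_X]
        change t i ∈ IsLocalRing.maximalIdeal S
        rw [hm]
        exact Ideal.subset_span ⟨i, rfl⟩
    exact hle (Ideal.mem_map_of_mem _ hp)
  have hspan : ∀ J : Ideal S, I ⊔ m ^ M ≤ J → Submodule.span ℂ (Set.range
      fun s : Finset (Fin N) => Ideal.Quotient.mk J (∏ i ∈ s, t i)) = ⊤ := by
    intro J hJ
    rw [eq_top_iff]
    rintro x -
    obtain ⟨x, rfl⟩ := Ideal.Quotient.mk_surjective x
    obtain ⟨p, hp⟩ := exists_sub_aeval_mem_maximalIdeal_pow hm hres M x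
    have hp2 : p ∈ (⊤ : Submodule ℂ (MvPolynomial (Fin N) ℂ)) := trivial
    rw [← hf] at hp2
    obtain ⟨a, ha, b, hb, rfl⟩ := Submodule.mem_sup.1 hp2
    have e : Ideal.Quotient.mk J x = Ideal.Quotient.mkₐ ℂ J (aeval t a) := by
      refine Ideal.Quotient.eq.2 ?_
      have h2 := hJ (hfm b hb)
      have h1 := hJ (Ideal.mem_sup_right hp)
      have := J.add_mem h1 h2
      rw [map_add] at this
      convert this using 1
      ring
    rw [e]
    have h3 := Submodule.mem_map_of_mem
      (f := ((Ideal.Quotient.mkₐ ℂ J).comp (aeval t)).toLinearMap) ha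
    rw [Submodule.map_span, ← Set.range_comp] at h3
    refine Submodule.span_mono ?_ h3
    rintro _ ⟨s, rfl⟩
    exact ⟨s, by simp [map_prod]⟩
  have hfin : ∀ J : Ideal S, I ⊔ m ^ M ≤ J →
      Module.Finite ℂ (S ⧸ J) ∧ Module.finrank ℂ (S ⧸ J) ≤ 2 ^ N := by
    intro J hJ
    have h := hspan J hJ
    refine ⟨⟨⟨(Set.finite_range _).toFinset, by simpa using h⟩⟩, ?_⟩
    have := finrank_range_le_card (R := ℂ)
      fun s : Finset (Fin N) => Ideal.Quotient.mk J (∏ i ∈ s, t i)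
    rw [Set.finrank, h, finrank_top] at this
    simpa using this
  have hmI : m ^ M ≤ I := by
    by_contra hnot
    -- If two consecutive terms agreed, Nakayama's lemma would give `m ^ j ≤ I`. Otherwise the chain
    -- has `M` strict steps, too many for dimension at most `2 ^ N`.
    have hchain : ∀ j < M, I ⊔ m ^ (j + 1) < I ⊔ m ^ j := by
      intro j hj
      refine lt_of_le_of_ne (sup_le_sup_left (Ideal.pow_le_pow_right (by omega)) _) fun heq => hnot ?_
      have hfg : (m ^ j).FG := by
        refine Ideal.FG.pow ?_
        change (IsLocalRing.maximalIdeal S).FG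
        rw [hm]
        exact Submodule.fg_span (Set.finite_range t)
      have h1 : m ^ j ≤ I := by
        refine Submodule.le_of_le_smul_of_le_jacobson_bot (I := m) hfg
          (IsLocalRing.maximalIdeal_le_jacobson _) ?_
        rw [smul_eq_mul, ← pow_succ', heq]
        exact le_sup_right
      exact (Ideal.pow_le_pow_right hj.le).trans h1
    have := (hfin _ le_rfl).1
    have h1 := le_finrank_quotient_of_strict_chain (fun j => I ⊔ m ^ j) M hchain
    have h2 := (hfin _ le_rfl).2
    omega
  have hI' : I ⊔ m ^ M = I := sup_eq_left.2 hmI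
  obtain ⟨h1, h2⟩ := hfin I hI'.le
  calc Module.length S (S ⧸ I) = Module.length S (⊤ : Submodule S (S ⧸ I)) := Module.length_top.symm
    _ ≤ Module.length ℂ ((⊤ : Submodule S (S ⧸ I)).restrictScalars ℂ) :=
      Submodule.length_le_length_restrictScalars ℂ _
    _ = Module.length ℂ (S ⧸ I) := by rw [Submodule.restrictScalars_top, Module.length_top]
    _ = Module.finrank ℂ (S ⧸ I) := Module.length_eq_finrank ℂ _
    _ ≤ _ := by exact_mod_cast h2

end LocalLength

/-! ### Homogeneous forms, their coefficients, and linear changes of coordinates -/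

lemma MvPolynomial.IsHomogeneous.aeval_mul_left {σ R S : Type} [CommRing R] [CommRing S]
    [Algebra R S] {H : MvPolynomial σ R} {n : ℕ} (hH : H.IsHomogeneous n) (c : S) (u : σ → S) :
    MvPolynomial.aeval (fun i => c * u i) H = c ^ n * MvPolynomial.aeval u H := by
  simp only [aeval_def, eval₂_eq, Finset.mul_sum]
  refine Finset.sum_congr rfl fun m hm => ?_
  have hdeg : m.degree = n := by
    by_contra h
    exact mem_support_iff.1 hm (hH.coeff_eq_zero h)
  rw [← hdeg, Finsupp.degree_apply, Finset.prod_congr rfl fun i _ => mul_pow c (u i) (m i),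
    Finset.prod_mul_distrib, Finset.prod_pow_eq_pow_sum]
  ring

lemma MvPolynomial.IsHomogeneous.eval_smul' {σ R : Type} [CommRing R]
    {H : MvPolynomial σ R} {n : ℕ} (hH : H.IsHomogeneous n) (c : R) (u : σ → R) :
    MvPolynomial.eval (c • u) H = c ^ n * MvPolynomial.eval u H := by
  have := hH.aeval_mul_left c u
  exact this

/-- Polynomials that vanish on a union of lines through the origin have homogeneous components
with this property. -/
lemma exists_homogeneous_vanishing {I : Type} {P : MvPolynomial I ℂ} (hP : P ≠ 0)
    (B : Set (I → ℂ)) (hB : ∀ b ∈ B, ∀ c : ℂ, eval (c • b) P = 0) :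
    ∃ (Q : MvPolynomial I ℂ) (n : ℕ), Q ≠ 0 ∧ Q.IsHomogeneous n ∧ ∀ b ∈ B, eval b Q = 0 := by
  obtain ⟨n, hn⟩ : ∃ n, homogeneousComponent n P ≠ 0 := by
    by_contra! h
    exact hP (by rw [← sum_homogeneousComponent P]; exact Finset.sum_eq_zero fun n _ => h n)
  refine ⟨_, n, hn, homogeneousComponent_isHomogeneous n P, fun b hb => ?_⟩
  -- Along the line through `b`, `P` is a polynomial in the scalar whose coefficients are the values
  -- at `b` of the homogeneous components. It vanishes identically, hence so do these values.
  let p : Polynomial ℂ := ∑ i ∈ Finset.range (P.totalDegree + 1),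
    Polynomial.C (eval b (homogeneousComponent i P)) * Polynomial.X ^ i
  have hp : p = 0 := by
    refine Polynomial.funext fun c => ?_
    rw [Polynomial.eval_zero, ← hB b hb c]
    conv_rhs => rw [← sum_homogeneousComponent P, map_sum]
    rw [Polynomial.eval_finsetSum]
    refine Finset.sum_congr rfl fun i _ => ?_
    rw [(homogeneousComponent_isHomogeneous i P).eval_smul']
    rw [Polynomial.eval_mul, Polynomial.eval_C, Polynomial.eval_pow, Polynomial.eval_X, mul_comm]
  have hcoeff := congrArg (Polynomial.coeff · n) hp
  simp only [p, Polynomial.finsetSum_coeff, Polynomial.coeff_C_mul_X_pow, Polynomial.coeff_zero,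
    Finset.sum_ite_eq] at hcoeff
  rw [if_pos] at hcoeff
  · exact hcoeff
  · rw [Finset.mem_range]
    by_contra h
    exact hn (homogeneousComponent_eq_zero _ _ (by omega))

/-- The index set for the coefficients of `N + 1` forms of degree `d`. -/
abbrev CoeffIndex (N d : ℕ) : Type := Fin (N + 1) × {m : Fin (N + 1) →₀ ℕ // m.degree = d}

instance (N d : ℕ) : Finite {m : Fin (N + 1) →₀ ℕ // m.degree = d} :=
  Set.Finite.to_subtype ((Finsupp.finite_of_degree_le d).subset fun _ h => le_of_eq h)

noncomputable instance (N d : ℕ) : Fintype {m : Fin (N + 1) →₀ ℕ // m.degree = d} :=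
  Fintype.ofFinite _

section Forms

variable {N d : ℕ} {R : Type} [CommRing R]

/-- The forms with given coefficients. -/
noncomputable def formOf (y : CoeffIndex N d → R) (j : Fin (N + 1)) :
    MvPolynomial (Fin (N + 1)) R :=
  ∑ m : {m : Fin (N + 1) →₀ ℕ // m.degree = d}, monomial m.1 (y (j, m))

lemma isHomogeneous_formOf (y : CoeffIndex N d → R) (j) : (formOf y j).IsHomogeneous d :=
  IsHomogeneous.sum _ _ _ fun m _ => isHomogeneous_monomial _ m.2

lemma coeff_formOf (y : CoeffIndex N d → R) (k : CoeffIndex N d) :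
    coeff k.2.1 (formOf y k.1) = y k := by
  classical
  rw [formOf, coeff_sum, Finset.sum_eq_single k.2]
  · rw [coeff_monomial, if_pos rfl]
  · intro m _ hm
    rw [coeff_monomial, if_neg fun h => hm (Subtype.ext h)]
  · simp

lemma formOf_coeff {H : Fin (N + 1) → MvPolynomial (Fin (N + 1)) R}
    (hH : ∀ j, (H j).IsHomogeneous d) :
    formOf (fun k : CoeffIndex N d => coeff k.2.1 (H k.1)) = H := by
  funext j
  ext m
  by_cases hm : m.degree = d
  · exact coeff_formOf _ (j, ⟨m, hm⟩)
  · rw [(isHomogeneous_formOf _ j).coeff_eq_zero hm, (hH j).coeff_eq_zero hm]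

lemma map_formOf {S : Type} [CommRing S] (φ : R →+* S) (y : CoeffIndex N d → R) (j) :
    map φ (formOf y j) = formOf (fun k => φ (y k)) j := by
  simp [formOf, map_monomial]

lemma formOf_smul (c : R) (y : CoeffIndex N d → R) (j) :
    formOf (c • y) j = C c * formOf y j := by
  simp only [formOf, Finset.mul_sum, C_mul_monomial]
  rfl

/-- The forms `B ∘ G ∘ A`. -/
noncomputable def transform (A B : Matrix (Fin (N + 1)) (Fin (N + 1)) R)
    (G : Fin (N + 1) → MvPolynomial (Fin (N + 1)) R) (j : Fin (N + 1)) :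
    MvPolynomial (Fin (N + 1)) R :=
  ∑ l, C (B j l) * aeval (fun i => ∑ m, C (A i m) * X m) (G l)

variable (A B : Matrix (Fin (N + 1)) (Fin (N + 1)) R)

lemma isHomogeneous_transform {G : Fin (N + 1) → MvPolynomial (Fin (N + 1)) R}
    (hG : ∀ j, (G j).IsHomogeneous d) (j) : (transform A B G j).IsHomogeneous d := by
  refine IsHomogeneous.sum _ _ _ fun l _ => ?_
  have h := (hG l).aeval (n := 1) (fun i => ∑ m, C (A i m) * X m)
    fun i => IsHomogeneous.sum _ _ _ fun m _ => isHomogeneous_C_mul_X _ _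
  rw [one_mul] at h
  exact h.C_mul _

lemma aeval_transform {S : Type} [CommRing S] [Algebra R S]
    (G : Fin (N + 1) → MvPolynomial (Fin (N + 1)) R) (v : Fin (N + 1) → S) (j) :
    aeval v (transform A B G j) =
      ∑ l, algebraMap R S (B j l) * aeval (fun i => ∑ m, algebraMap R S (A i m) * v m) (G l) := by
  rw [transform, map_sum]
  refine Finset.sum_congr rfl fun l _ => ?_
  rw [map_mul, aeval_C, ← AlgHom.comp_apply, comp_aeval]
  simp

lemma eval_transform (G : Fin (N + 1) → MvPolynomial (Fin (N + 1)) R) (v : Fin (N + 1) → R) (j) :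
    eval v (transform A B G j) = B.mulVec (fun l => eval (A.mulVec v) (G l)) j := by
  exact aeval_transform A B G v j

lemma transform_smul (c : R) (G : Fin (N + 1) → MvPolynomial (Fin (N + 1)) R) (j) :
    transform A B (fun l => C c * G l) j = C c * transform A B G j := by
  rw [transform, transform, Finset.mul_sum]
  refine Finset.sum_congr rfl fun l _ => ?_
  rw [map_mul, ← algebraMap_eq, AlgHom.commutes, algebraMap_eq]
  ring

lemma map_transform {S : Type} [CommRing S] (φ : R →+* S)
    (G : Fin (N + 1) → MvPolynomial (Fin (N + 1)) R) (j) :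
    map φ (transform A B G j) = transform (A.map φ) (B.map φ) (fun l => map φ (G l)) j := by
  rw [transform, transform, map_sum]
  refine Finset.sum_congr rfl fun l _ => ?_
  rw [map_mul, map_C, Matrix.map_apply]
  congr 1
  generalize G l = g
  induction g using MvPolynomial.induction_on with
  | C c => simp [← algebraMap_eq]
  | add p q hp hq => simp only [map_add, hp, hq]
  | mul_X p i hp => simp only [map_mul, hp, aeval_X, map_X, map_sum, map_C, Matrix.map_apply]

lemma transform_transform {A B A' B' : Matrix (Fin (N + 1)) (Fin (N + 1)) ℂ}
    (hA : A' * A = 1) (hB : B * B' = 1) (G : Fin (N + 1) → MvPolynomial (Fin (N + 1)) ℂ) :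
    transform A B (transform A' B' G) = G := by
  funext j
  refine MvPolynomial.funext fun v => ?_
  have h : (fun l => eval (A.mulVec v) (transform A' B' G l)) =
      B'.mulVec fun l => eval v (G l) := by
    funext l
    rw [eval_transform, Matrix.mulVec_mulVec, hA, Matrix.one_mulVec]
  rw [eval_transform, h, Matrix.mulVec_mulVec, hB, Matrix.one_mulVec]

/-- A matrix that maps the first unit vector to the point with affine coordinates `a` in the
`i`-th standard chart. -/
noncomputable def chart (i : Fin (N + 1)) (a : Fin N → R) :
    Matrix (Fin (N + 1)) (Fin (N + 1)) R :=
  (Equiv.swap 0 i).permMatrix R * (1 + Matrix.vecMulVec (Fin.cons 0 a) (Pi.single 0 1))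

/-- The inverse of `chart`. -/
noncomputable def chartInv (i : Fin (N + 1)) (a : Fin N → R) :
    Matrix (Fin (N + 1)) (Fin (N + 1)) R :=
  (1 - Matrix.vecMulVec (Fin.cons 0 a) (Pi.single 0 1)) * (Equiv.swap 0 i).permMatrix R

lemma permMatrix_swap_mul_self (i : Fin (N + 1)) :
    (Equiv.swap 0 i).permMatrix R * (Equiv.swap 0 i).permMatrix R = 1 := by
  rw [← Matrix.permMatrix_mul, Equiv.swap_mul_self, Matrix.permMatrix_one]

lemma vecMulVec_cons_mul_self (a : Fin N → R) :
    Matrix.vecMulVec (Fin.cons 0 a) (Pi.single 0 1) *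
      Matrix.vecMulVec (Fin.cons 0 a) (Pi.single 0 1) =
        (0 : Matrix (Fin (N + 1)) (Fin (N + 1)) R) := by
  rw [Matrix.vecMulVec_mul_vecMulVec]
  simp

lemma chart_mul_chartInv (i : Fin (N + 1)) (a : Fin N → R) : chart i a * chartInv i a = 1 := by
  rw [chart, chartInv, Matrix.mul_assoc, ← Matrix.mul_assoc (1 + _), add_mul, mul_sub, mul_sub,
    vecMulVec_cons_mul_self]
  simp [permMatrix_swap_mul_self]

lemma chartInv_mul_chart (i : Fin (N + 1)) (a : Fin N → R) : chartInv i a * chart i a = 1 := by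
  rw [chart, chartInv, Matrix.mul_assoc, ← Matrix.mul_assoc (Equiv.Perm.permMatrix _ _),
    permMatrix_swap_mul_self, Matrix.one_mul, sub_mul, mul_add, mul_add, vecMulVec_cons_mul_self]
  simp

lemma map_vecMulVec_cons {S : Type} [CommRing S] (φ : R →+* S) (a : Fin N → R) :
    (Matrix.vecMulVec (Fin.cons 0 a) (Pi.single 0 1) : Matrix (Fin (N + 1)) (Fin (N + 1)) R).map φ =
      Matrix.vecMulVec (Fin.cons 0 fun i => φ (a i)) (Pi.single 0 1) := by
  ext r c
  rw [Matrix.map_apply, Matrix.vecMulVec_apply, Matrix.vecMulVec_apply, map_mul]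
  congr 1
  · cases r using Fin.cases <;> simp
  · by_cases h : c = 0
    · subst h; simp
    · simp [h]

lemma map_permMatrix {S : Type} [CommRing S] (φ : R →+* S) (σ : Equiv.Perm (Fin (N + 1))) :
    (σ.permMatrix R).map φ = σ.permMatrix S := by
  ext r c
  simp [Equiv.Perm.permMatrix, PEquiv.toMatrix_apply, apply_ite φ]

lemma map_chart {S : Type} [CommRing S] (φ : R →+* S) (i : Fin (N + 1)) (a : Fin N → R) :
    (chart i a).map φ = chart i fun j => φ (a j) := by
  rw [chart, Matrix.map_mul, Matrix.map_add _ (map_add φ), map_permMatrix, map_vecMulVec_cons,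
    Matrix.map_one _ (map_zero φ) (map_one φ), chart]

lemma map_chartInv {S : Type} [CommRing S] (φ : R →+* S) (i : Fin (N + 1)) (a : Fin N → R) :
    (chartInv i a).map φ = chartInv i fun j => φ (a j) := by
  rw [chartInv, Matrix.map_mul, Matrix.map_sub _ (map_sub φ), map_permMatrix, map_vecMulVec_cons,
    Matrix.map_one _ (map_zero φ) (map_one φ), chartInv]

lemma exists_eq_smul_chart {v : Fin (N + 1) → ℂ} (hv : v ≠ 0) :
    ∃ (i : Fin (N + 1)) (a : Fin N → ℂ) (c : ℂ), c ≠ 0 ∧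
      v = c • (chart i a).mulVec (Pi.single 0 1) := by
  obtain ⟨i, hi⟩ := Function.ne_iff.1 hv
  have hi' : v i ≠ 0 := hi
  refine ⟨i, fun j => v (Equiv.swap 0 i j.succ) / v i, v i, hi', ?_⟩
  rw [chart, ← Matrix.mulVec_mulVec, Matrix.add_mulVec, Matrix.one_mulVec,
    Matrix.vecMulVec_mulVec, Matrix.permMatrix_mulVec]
  funext r
  obtain ⟨r, rfl⟩ := (Equiv.swap 0 i).surjective r
  simp only [Pi.smul_apply, Function.comp_apply, Equiv.swap_apply_self, smul_eq_mul, Pi.add_apply]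
  cases r using Fin.cases with
  | zero => simp
  | succ r => simp; field_simp

end Forms

/-! ### Hypersurfaces that contain the exceptional tuples -/

section Elimination

variable {N d : ℕ}

/-- The coefficients of `B ∘ G ∘ A` are polynomials in the parameters and the coefficients of `G`,
so elimination applies. The relation can be made homogeneous because the cone is stable under
scaling and `transform` is linear in the tuple. -/
theorem exists_homogeneous_vanishing_on_transforms {E T : Type} [Fintype E] [Fintype T]
    (𝒢 : Set (MvPolynomial (CoeffIndex N d) ℂ)) (h𝒢 : ∀ g ∈ 𝒢, ∃ n, g.IsHomogeneous n)
    (h0 : ∀ g ∈ 𝒢, eval 0 g = 0) (L : (E → ℂ) →ₗ[ℂ] (CoeffIndex N d → ℂ))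
    (hL : ∀ z, (∀ g ∈ 𝒢, eval (L z) g = 0) → z = 0)
    (A B : Matrix (Fin (N + 1)) (Fin (N + 1)) (MvPolynomial T ℂ))
    (hcard : Fintype.card T < Fintype.card E) :
    ∃ (P : MvPolynomial (CoeffIndex N d) ℂ) (n : ℕ), P ≠ 0 ∧ P.IsHomogeneous n ∧
      ∀ (t : T → ℂ) (y : CoeffIndex N d → ℂ), (∀ g ∈ 𝒢, eval y g = 0) →
        eval (fun k => coeff k.2.1
          (transform (A.map (eval t)) (B.map (eval t)) (formOf y) k.1)) P = 0 := by
  obtain ⟨P, hP, hvan⟩ := exists_ne_zero_vanishing_on_family 𝒢 h𝒢 h0 L hL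
    (fun k => coeff k.2.1 (transform (A.map (rename (Sum.inl : T → T ⊕ CoeffIndex N d)))
      (B.map (rename Sum.inl)) (formOf fun k' => X (Sum.inr k')) k.1)) hcard
  have hw : ∀ (t : T → ℂ) (y : CoeffIndex N d → ℂ) (k : CoeffIndex N d),
      eval (Sum.elim t y) (coeff k.2.1 (transform (A.map (rename (Sum.inl : T → T ⊕ CoeffIndex N d)))
        (B.map (rename Sum.inl)) (formOf fun k' => X (Sum.inr k')) k.1)) =
      coeff k.2.1 (transform (A.map (eval t)) (B.map (eval t)) (formOf y) k.1) := by
    intro t y k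
    have hm : ∀ C : Matrix (Fin (N + 1)) (Fin (N + 1)) (MvPolynomial T ℂ),
        (C.map (rename (Sum.inl : T → T ⊕ CoeffIndex N d))).map (eval (Sum.elim t y)) =
          C.map (eval t) := by
      intro C
      ext r c
      simp [eval_rename]
    rw [← coeff_map, map_transform, hm, hm]
    simp only [map_formOf, eval_X, Sum.elim_inr]
  obtain ⟨Q, n, hQ, hn, hvanQ⟩ := exists_homogeneous_vanishing hP
    {b | ∃ (t : T → ℂ) (y : CoeffIndex N d → ℂ), (∀ g ∈ 𝒢, eval y g = 0) ∧ b = fun k => coeff k.2.1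
          (transform (A.map (eval t)) (B.map (eval t)) (formOf y) k.1)} (by
      rintro _ ⟨t, y, hy, rfl⟩ c
      rw [← hvan t (c • y) fun g hg => by
        obtain ⟨n, hn⟩ := h𝒢 g hg
        rw [hn.eval_smul', hy g hg, mul_zero]]
      refine congrArg (fun u => eval u P) (funext fun k => ?_)
      rw [hw]
      have : (formOf (c • y) : Fin (N + 1) → MvPolynomial (Fin (N + 1)) ℂ) =
        fun j => C c * formOf y j := funext fun j => formOf_smul c y j
      rw [this, transform_smul, coeff_C_mul]
      rfl)
  exact ⟨Q, n, hQ, hn, fun t y hy => hvanQ _ ⟨t, y, hy, rfl⟩⟩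

lemma prod_ne_zero_and_isHomogeneous {J I : Type} [Fintype J] (P : J → MvPolynomial I ℂ)
    (hP : ∀ j, P j ≠ 0) (n : J → ℕ) (hn : ∀ j, (P j).IsHomogeneous (n j)) :
    (∏ j, P j) ≠ 0 ∧ (∏ j, P j).IsHomogeneous (∑ j, n j) :=
  ⟨Finset.prod_ne_zero_iff.2 fun j _ => hP j, IsHomogeneous.prod _ _ _ fun j _ => hn j⟩

/-- The exponent of `x_0 ^ d`. -/
noncomputable def constIndex (N d : ℕ) : {m : Fin (N + 1) →₀ ℕ // m.degree = d} :=
  ⟨Finsupp.single 0 d, Finsupp.degree_single _ _⟩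

lemma eval_single_formOf (y : CoeffIndex N d → ℂ) (j : Fin (N + 1)) :
    eval (Pi.single 0 1) (formOf y j) = y (j, constIndex N d) := by
  classical
  rw [formOf, map_sum, Finset.sum_eq_single (constIndex N d)]
  · rw [eval_monomial]
    simp [constIndex]
  · intro m _ hm
    rw [eval_monomial]
    obtain ⟨i, hi, h0⟩ : ∃ i : Fin (N + 1), i ≠ 0 ∧ m.1 i ≠ 0 := by
      by_contra! h
      apply hm
      have h1 : m.1 = Finsupp.single 0 (m.1 0) := by
        ext i
        by_cases hi : i = 0
        · subst hi; simp
        · rw [h i hi, Finsupp.single_eq_of_ne hi]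
      have h2 := m.2
      rw [h1, Finsupp.degree_single] at h2
      exact Subtype.ext (by rw [h1, h2]; rfl)
    rw [Finsupp.prod, Finset.prod_eq_zero (Finsupp.mem_support_iff.2 h0), mul_zero]
    rw [Pi.single_eq_of_ne hi, zero_pow h0]
  · simp

/-- A general tuple of forms has no common zero. -/
theorem exists_resultant (N d : ℕ) :
    ∃ (P : MvPolynomial (CoeffIndex N d) ℂ) (n : ℕ), P ≠ 0 ∧ P.IsHomogeneous n ∧
      ∀ y, eval y P ≠ 0 → ∀ v, (∀ j, eval v (formOf y j) = 0) → v = 0 := by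
  classical
  -- The cone consists of the tuples that vanish at `e₀`; the test space, of dimension `N + 1`,
  -- consists of the tuples of multiples of `X 0 ^ d`. The point `e₀` is moved by only `N` affine
  -- parameters in each chart.
  let 𝒢 : Set (MvPolynomial (CoeffIndex N d) ℂ) := Set.range fun j => X (j, constIndex N d)
  let L : (Fin (N + 1) → ℂ) →ₗ[ℂ] (CoeffIndex N d → ℂ) :=
    LinearMap.pi fun k => if k.2 = constIndex N d then LinearMap.proj k.1 else 0
  have hex := fun i : Fin (N + 1) => exists_homogeneous_vanishing_on_transforms (T := Fin N) 𝒢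
    (by rintro _ ⟨j, rfl⟩; exact ⟨1, isHomogeneous_X _ _⟩)
    (by rintro _ ⟨j, rfl⟩; simp) L
    (by
      intro z hz
      funext j
      simpa [L] using hz _ ⟨j, rfl⟩)
    (chartInv i X) 1 (by simp)
  choose P n hP hn hvan using hex
  obtain ⟨h1, h2⟩ := prod_ne_zero_and_isHomogeneous P hP n hn
  refine ⟨_, _, h1, h2, fun y hy v hv => ?_⟩
  by_contra hv0
  obtain ⟨i, a, c, hc, hvc⟩ := exists_eq_smul_chart hv0
  rw [map_prod, Finset.prod_ne_zero_iff] at hy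
  apply hy i (Finset.mem_univ i)
  have hG := fun j => isHomogeneous_transform (chart i a) 1
    (fun l => isHomogeneous_formOf y l) j
  -- Moving the common zero to `e₀` puts the tuple in the cone; undoing the move exhibits `y` as a
  -- member of the family on which `P i` vanishes.
  let y' : CoeffIndex N d → ℂ := fun r => coeff r.2.1 (transform (chart i a) 1 (formOf y) r.1)
  have hy' : formOf y' = transform (chart i a) 1 (formOf y) := formOf_coeff hG
  have h3 := hvan i a y' (by
    rintro _ ⟨j, rfl⟩
    rw [eval_X]
    refine (eval_single_formOf y' j).symm.trans ?_
    rw [hy', eval_transform, Matrix.one_mulVec]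
    have h4 := hv j
    rw [hvc, (isHomogeneous_formOf y j).eval_smul'] at h4
    exact (mul_eq_zero.1 h4).resolve_left (pow_ne_zero _ hc))
  rw [hy', map_chartInv, Matrix.map_one _ (map_zero _) (map_one _)] at h3
  simp only [eval_X] at h3
  rw [transform_transform (chart_mul_chartInv i a) (one_mul 1)] at h3
  simpa only [coeff_formOf] using h3

/-- The substitution `x_0 = 1`. -/
noncomputable def dehom (N : ℕ) : MvPolynomial (Fin (N + 1)) ℂ →ₐ[ℂ] MvPolynomial (Fin N) ℂ :=
  aeval (Fin.cons 1 X)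

/-- The minors of the coefficient matrix that detects `SquarefreeSpans`. -/
noncomputable def spanMinor (N d M : ℕ) (σ : NonSquarefree N M → (Fin N →₀ ℕ) × Fin N) :
    MvPolynomial (CoeffIndex N d) ℂ :=
  open Classical in
  (Matrix.of fun k l : NonSquarefree N M => ∑ m : {m : Fin (N + 1) →₀ ℕ // m.degree = d},
    C (coeff l.1 (monomial (σ k).1 1 * dehom N (monomial m.1 1))) * X ((σ k).2.succ, m)).det

lemma isHomogeneous_spanMinor (N d M : ℕ) (σ) :
    (spanMinor N d M σ).IsHomogeneous (Fintype.card (NonSquarefree N M)) := by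
  classical
  rw [spanMinor, Matrix.det_apply]
  refine IsHomogeneous.sum _ _ _ fun τ _ => ?_
  have h : (∏ i, (Matrix.of fun k l : NonSquarefree N M =>
      ∑ m : {m : Fin (N + 1) →₀ ℕ // m.degree = d},
        C (coeff l.1 (monomial (σ k).1 1 * dehom N (monomial m.1 1))) *
          (X ((σ k).2.succ, m) : MvPolynomial (CoeffIndex N d) ℂ)) (τ i) i).IsHomogeneous
      (∑ _i : NonSquarefree N M, 1) :=
    IsHomogeneous.prod _ _ _ fun i _ => IsHomogeneous.sum _ _ _ fun m _ =>
      isHomogeneous_C_mul_X _ _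
  rw [Finset.sum_const, smul_eq_mul, mul_one, Finset.card_univ] at h
  rcases Int.units_eq_one_or (Equiv.Perm.sign τ) with e | e
  · rw [e, one_smul]; exact h
  · rw [e, Units.neg_smul, one_smul]; exact h.neg

lemma eval_spanMinor (y : CoeffIndex N d → ℂ) (M : ℕ) (σ) :
    eval y (spanMinor N d M σ) = open Classical in
      (Matrix.of fun k l : NonSquarefree N M => coeff l.1 (monomial (σ k).1 1 *
        dehom N (formOf y (σ k).2.succ))).det := by
  classical
  rw [spanMinor, RingHom.map_det]
  congr 1
  ext k l
  rw [RingHom.mapMatrix_apply, Matrix.map_apply, Matrix.of_apply, Matrix.of_apply, map_sum, formOf,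
    map_sum, Finset.mul_sum, coeff_sum]
  refine Finset.sum_congr rfl fun m _ => ?_
  have e : monomial m.1 (y ((σ k).2.succ, m)) =
      y ((σ k).2.succ, m) • (monomial m.1 (1 : ℂ)) := by
    rw [smul_monomial, smul_eq_mul, mul_one]
  rw [e, map_smul, mul_smul_comm, coeff_smul, smul_eq_mul, map_mul, eval_C, eval_X, mul_comm]

lemma squarefreeSpans_iff_exists_spanMinor (y : CoeffIndex N d → ℂ) (M : ℕ) :
    SquarefreeSpans (fun s : Fin N => dehom N (formOf y s.succ)) M ↔
      ∃ σ, eval y (spanMinor N d M σ) ≠ 0 := by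
  classical
  rw [squarefreeSpans_iff_span_eq_top, ← exists_det_ne_zero_iff_span_eq_top]
  refine exists_congr fun σ => ?_
  rw [eval_spanMinor]

/-- Forms whose dehomogenization is a constant plus a `quadraticSystem`. -/
noncomputable def quadraticForms (d : ℕ) (z : Fin N ⊕ Fin (N + 1) → ℂ) (j : Fin (N + 1)) :
    MvPolynomial (Fin (N + 1)) ℂ :=
  Fin.cases 0 (fun s : Fin N => C (z (Sum.inl s)) * X 0 ^ d + ∑ i : Fin N,
    (C (extendByZero (fun r => z (Sum.inr r)) (s - i)) * (X 0 ^ (d - 1) * X i.succ) +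
      C (extendByZero (fun r => z (Sum.inr r)) (s - i + N)) * (X 0 ^ (d - 2) * X i.succ ^ 2))) j

lemma isHomogeneous_quadraticForms (hd : 2 ≤ d) (z : Fin N ⊕ Fin (N + 1) → ℂ) (j) :
    (quadraticForms d z j).IsHomogeneous d := by
  cases j using Fin.cases with
  | zero => exact isHomogeneous_zero _ _ _
  | succ s =>
    refine ((isHomogeneous_X_pow _ _).C_mul _).add (IsHomogeneous.sum _ _ _ fun i _ => ?_)
    refine (IsHomogeneous.C_mul ?_ _).add (IsHomogeneous.C_mul ?_ _)
    · have := (isHomogeneous_X_pow (R := ℂ) (0 : Fin (N + 1)) (d - 1)).mul (isHomogeneous_X ℂ i.succ)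
      rwa [Nat.sub_add_cancel (by omega)] at this
    · have := (isHomogeneous_X_pow (R := ℂ) (0 : Fin (N + 1)) (d - 2)).mul
        (isHomogeneous_X_pow (R := ℂ) i.succ 2)
      rwa [Nat.sub_add_cancel (by omega)] at this

lemma dehom_quadraticForms (z : Fin N ⊕ Fin (N + 1) → ℂ) (s : Fin N) :
    dehom N (quadraticForms d z s.succ) =
      C (z (Sum.inl s)) + quadraticSystem (fun r => z (Sum.inr r)) s := by
  simp [dehom, quadraticForms, quadraticSystem, ← algebraMap_eq]

lemma extendByZero_add (c c' : Fin (N + 1) → ℂ) (n : ℤ) :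
    extendByZero (fun r => c r + c' r) n = extendByZero c n + extendByZero c' n := by
  unfold extendByZero; split_ifs <;> simp

lemma extendByZero_smul (a : ℂ) (c : Fin (N + 1) → ℂ) (n : ℤ) :
    extendByZero (fun r => a * c r) n = a * extendByZero c n := by
  unfold extendByZero; split_ifs <;> simp

lemma quadraticForms_add (z z' : Fin N ⊕ Fin (N + 1) → ℂ) (j) :
    quadraticForms d (z + z') j = quadraticForms d z j + quadraticForms d z' j := by
  cases j using Fin.cases with
  | zero => simp [quadraticForms]
  | succ s =>
    simp only [quadraticForms, Fin.cases_succ, extendByZero_add, Pi.add_apply, map_add, add_mul,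
      Finset.sum_add_distrib]
    ring

lemma quadraticForms_smul (a : ℂ) (z : Fin N ⊕ Fin (N + 1) → ℂ) (j) :
    quadraticForms d (a • z) j = a • quadraticForms d z j := by
  cases j using Fin.cases with
  | zero => simp [quadraticForms]
  | succ s =>
    simp only [quadraticForms, Fin.cases_succ, extendByZero_smul, Pi.smul_apply, map_mul,
      smul_eq_mul, smul_eq_C_mul, mul_add, Finset.mul_sum, Finset.sum_add_distrib, mul_assoc]

/-- In a general tuple of forms, every fibre is of bounded multiplicity in the sense of
`SquarefreeSpans`. -/
theorem exists_generic_squarefreeSpans (hN : 0 < N) (hd : 2 ≤ d) {M : ℕ} (hM : 2 < M) :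
    ∃ (P : MvPolynomial (CoeffIndex N d) ℂ) (n : ℕ), P ≠ 0 ∧ P.IsHomogeneous n ∧
      ∀ y, eval y P ≠ 0 → ∀ (i k : Fin (N + 1)) (a b : Fin N → ℂ),
        (∀ s : Fin N, eval (Pi.single 0 1)
          (transform (chart i a) (chartInv k b) (formOf y) s.succ) = 0) →
        SquarefreeSpans (fun s : Fin N =>
          dehom N (transform (chart i a) (chartInv k b) (formOf y) s.succ)) M := by
  classical
  let 𝒢 : Set (MvPolynomial (CoeffIndex N d) ℂ) :=
    (Set.range fun s : Fin N => X (s.succ, constIndex N d)) ∪ Set.range (spanMinor N d M)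
  -- The minors have positive degree and hence vanish at `0`, as elimination requires of a cone.
  have hne : Nonempty (NonSquarefree N M) :=
    ⟨⟨Finsupp.single ⟨0, hN⟩ 2, by simpa using hM, ⟨0, hN⟩, by simp⟩⟩
  -- The test space has dimension `2 * N + 1`, one more than the number of affine parameters for a
  -- source point and a target point.
  let L : (Fin N ⊕ Fin (N + 1) → ℂ) →ₗ[ℂ] (CoeffIndex N d → ℂ) :=
    { toFun z k := coeff k.2.1 (quadraticForms d z k.1)
      map_add' z z' := by funext k; rw [quadraticForms_add, coeff_add]; rfl
      map_smul' a z := by funext k; rw [quadraticForms_smul, coeff_smul]; rfl }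
  have hL : ∀ z, formOf (L z) = quadraticForms d z := fun z =>
    formOf_coeff (isHomogeneous_quadraticForms hd z)
  have hex := fun ik : Fin (N + 1) × Fin (N + 1) =>
    exists_homogeneous_vanishing_on_transforms (T := Fin N ⊕ Fin N) 𝒢
      (by
        rintro _ (⟨j, rfl⟩ | ⟨σ, rfl⟩)
        · exact ⟨1, isHomogeneous_X _ _⟩
        · exact ⟨_, isHomogeneous_spanMinor N d M σ⟩)
      (by
        rintro _ (⟨j, rfl⟩ | ⟨σ, rfl⟩)
        · simp
        · have := (isHomogeneous_spanMinor N d M σ).eval_smul' 0 0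
          rwa [smul_zero, zero_pow Fintype.card_ne_zero, zero_mul] at this) L
      (by
        intro z hz
        have h1 : ∀ s, z (Sum.inl s) = 0 := by
          intro s
          have h := hz _ (Or.inl ⟨s, rfl⟩)
          rw [eval_X] at h
          replace h := (eval_single_formOf (L z) s.succ).trans h
          rw [hL] at h
          simpa [quadraticForms] using h
        -- With the constants gone, the dehomogenized forms are a `quadraticSystem`. If it were
        -- nonzero it would satisfy the spanning condition, and some minor would not vanish.
        have h2 : (fun r => z (Sum.inr r)) = 0 := by
          by_contra hc
          have h3 := squarefreeSpans_of_sq_mem (fun i => sq_mem_of_quadraticSystem hc i) M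
          have h4 : (quadraticSystem fun r => z (Sum.inr r)) =
              fun s : Fin N => dehom N (formOf (L z) s.succ) := by
            funext s
            rw [hL, dehom_quadraticForms, h1, C_0, zero_add]
          rw [h4, squarefreeSpans_iff_exists_spanMinor] at h3
          obtain ⟨σ, hσ⟩ := h3
          exact hσ (hz _ (Or.inr ⟨σ, rfl⟩))
        funext r
        rcases r with s | r
        · exact h1 s
        · exact congrFun h2 r)
      (chartInv ik.1 fun j => X (Sum.inl j)) (chart ik.2 fun j => X (Sum.inr j))
      (by simp)
  choose P n hP hn hvan using hex
  obtain ⟨h1, h2⟩ := prod_ne_zero_and_isHomogeneous P hP n hn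
  refine ⟨_, _, h1, h2, fun y hy i k a b hG0 => ?_⟩
  by_contra hG1
  rw [map_prod, Finset.prod_ne_zero_iff] at hy
  apply hy (i, k) (Finset.mem_univ _)
  have hG := fun j => isHomogeneous_transform (chart i a) (chartInv k b)
    (fun l => isHomogeneous_formOf y l) j
  let y' : CoeffIndex N d → ℂ := fun r =>
    coeff r.2.1 (transform (chart i a) (chartInv k b) (formOf y) r.1)
  have hy' : formOf y' = transform (chart i a) (chartInv k b) (formOf y) := formOf_coeff hG
  have h3 := hvan (i, k) (Sum.elim a b) y' (by
      rintro _ (⟨s, rfl⟩ | ⟨σ, rfl⟩)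
      · rw [eval_X]
        refine (eval_single_formOf y' s.succ).symm.trans ?_
        rw [hy']
        exact hG0 s
      · by_contra hσ
        have := (squarefreeSpans_iff_exists_spanMinor y' M).2 ⟨σ, hσ⟩
        rw [hy'] at this
        exact hG1 this)
  rw [hy', map_chartInv, map_chart] at h3
  simp only [eval_X, Sum.elim_inl, Sum.elim_inr] at h3
  rw [transform_transform (chart_mul_chartInv i a) (chart_mul_chartInv k b)] at h3
  simpa only [coeff_formOf] using h3

end Elimination

/-! ### Degree one -/

section LinearCase

variable {N : ℕ}

lemma exists_eq_sum_of_isHomogeneous_one {H : MvPolynomial (Fin (N + 1)) ℂ}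
    (hH : H.IsHomogeneous 1) : ∃ γ : Fin (N + 1) → ℂ, H = ∑ m, C (γ m) * X m := by
  have h : H ∈ homogeneousSubmodule (Fin (N + 1)) ℂ 1 := hH
  rw [homogeneousSubmodule_one_eq_span_X, Submodule.mem_span_range_iff_exists_fun] at h
  obtain ⟨γ, rfl⟩ := h
  exact ⟨γ, by simp [smul_eq_C_mul]⟩

/-- An invertible matrix that fixes the line of `e₀` induces an isomorphism on the quotient by it.
The dehomogenized forms therefore generate all the variables, in particular their squares. -/
theorem squarefreeSpans_of_linear {G : Fin (N + 1) → MvPolynomial (Fin (N + 1)) ℂ}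
    (hG : ∀ j, (G j).IsHomogeneous 1) (hzero : ∀ v, (∀ j, eval v (G j) = 0) → v = 0)
    (h0 : ∀ s : Fin N, eval (Pi.single 0 1) (G s.succ) = 0) (M : ℕ) :
    SquarefreeSpans (fun s : Fin N => dehom N (G s.succ)) M := by
  choose Γ hΓ using fun j => exists_eq_sum_of_isHomogeneous_one (hG j)
  have hev : ∀ v j, eval v (G j) = (Matrix.of Γ).mulVec v j := by
    intro v j
    rw [hΓ]
    simp [Matrix.mulVec, dotProduct]
  have hcol : ∀ j, eval (Pi.single 0 1) (G j) = Γ j 0 := by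
    intro j
    rw [hev, Matrix.mulVec_single_one]
    rfl
  have hinj : Function.Injective (Matrix.of Γ).mulVec := by
    rw [← Matrix.coe_mulVecLin, injective_iff_map_eq_zero]
    intro v hv
    exact hzero v fun j => by rw [hev]; exact congrFun hv j
  have hunit := Matrix.mulVec_injective_iff_isUnit.1 hinj
  obtain ⟨Δ, hΔ⟩ := hunit.exists_left_inv
  have h00 : Γ 0 0 ≠ 0 := by
    intro h
    have := congrFun (hzero (Pi.single 0 1) fun j => by
      cases j using Fin.cases with
      | zero => rw [hcol, h]
      | succ s => exact h0 s) 0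
    simp at this
  -- The first column of `Γ` is `Γ 0 0` times the first unit vector, so the inverse also has zeros
  -- below its corner, and `X i.succ` does not involve `G 0`.
  have hΔ0 : ∀ i : Fin N, Δ i.succ 0 = 0 := by
    intro i
    have h := congrFun (congrFun hΔ i.succ) 0
    rw [Matrix.mul_apply, Fin.sum_univ_succ, Matrix.one_apply_ne (Fin.succ_ne_zero i),
      Finset.sum_eq_zero fun s _ => by rw [Matrix.of_apply, ← hcol, h0, mul_zero], add_zero] at h
    exact (mul_eq_zero.1 h).resolve_right h00
  have hX : ∀ i : Fin N, X i.succ = ∑ s : Fin N, C (Δ i.succ s.succ) * G s.succ := by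
    intro i
    refine MvPolynomial.funext fun v => ?_
    have h : Δ.mulVec ((Matrix.of Γ).mulVec v) i.succ = v i.succ := by
      rw [Matrix.mulVec_mulVec, hΔ, Matrix.one_mulVec]
    rw [Matrix.mulVec, dotProduct, Fin.sum_univ_succ, hΔ0, zero_mul, zero_add] at h
    rw [eval_X, map_sum, ← h]
    simp only [map_mul, eval_C, hev]
  refine squarefreeSpans_of_sq_mem (fun i => Ideal.mem_sup_left ?_) M
  have h1 := congrArg (dehom N) (hX i)
  rw [map_sum] at h1
  have h2 : dehom N (X i.succ) = X i := by simp [dehom]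
  rw [h2] at h1
  rw [pow_two, h1]
  refine Ideal.mul_mem_left _ _ (Ideal.sum_mem _ fun s _ => ?_)
  rw [map_mul]
  exact Ideal.mul_mem_left _ _ (Ideal.subset_span ⟨s, rfl⟩)

end LinearCase

/-! ### Affine coordinates in the local ring of projective space -/

section LocalRing

variable {N : ℕ}

/-- The linear form with coefficients `γ`. -/
noncomputable def linForm (γ : Fin (N + 1) → ℂ) : MvPolynomial (Fin (N + 1)) ℂ := ∑ m, C (γ m) * X m

lemma linForm_mem (γ : Fin (N + 1) → ℂ) : linForm γ ∈ homogeneousSubmodule (Fin (N + 1)) ℂ 1 :=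
  IsHomogeneous.sum _ _ _ fun _ _ => isHomogeneous_C_mul_X _ _

lemma eval_linForm (A : Matrix (Fin (N + 1)) (Fin (N + 1)) ℂ) (v : Fin (N + 1) → ℂ) (j) :
    eval v (linForm (A j)) = A.mulVec v j := by
  simp [linForm, Matrix.mulVec, dotProduct]

lemma eval_aeval_eq {σ τ : Type} (g : σ → MvPolynomial τ ℂ) (v : τ → ℂ) (H : MvPolynomial σ ℂ) :
    eval v (aeval g H) = eval (fun i => eval v (g i)) H := by
  induction H using MvPolynomial.induction_on with
  | C c => rw [← MvPolynomial.algebraMap_eq, AlgHom.commutes]; simp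
  | add p q hp hq => simp only [map_add, hp, hq]
  | mul_X p i hp => rw [map_mul, map_mul, map_mul, hp, aeval_X, eval_X]

lemma eval_aeval_linForm (A : Matrix (Fin (N + 1)) (Fin (N + 1)) ℂ) (v : Fin (N + 1) → ℂ)
    (H : MvPolynomial (Fin (N + 1)) ℂ) :
    eval v (aeval (fun j => linForm (A j)) H) = eval (A.mulVec v) H := by
  rw [eval_aeval_eq]
  have h : (fun j => eval v (linForm (A j))) = A.mulVec v := by
    ext j
    rw [eval_linForm]
  rw [h]

lemma aeval_linForm_linForm {A A' : Matrix (Fin (N + 1)) (Fin (N + 1)) ℂ} (h : A * A' = 1)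
    (H : MvPolynomial (Fin (N + 1)) ℂ) :
    aeval (fun j => linForm (A' j)) (aeval (fun i => linForm (A i)) H) = H := by
  refine MvPolynomial.funext fun v => ?_
  rw [eval_aeval_linForm, eval_aeval_linForm, Matrix.mulVec_mulVec, h, Matrix.one_mulVec]

lemma transform_eq_aeval_linForm (A B : Matrix (Fin (N + 1)) (Fin (N + 1)) ℂ)
    (G : Fin (N + 1) → MvPolynomial (Fin (N + 1)) ℂ) (j) :
    transform A B G j = aeval (fun i => linForm (A i)) (∑ l, C (B j l) * G l) := by
  rw [transform, map_sum]
  refine Finset.sum_congr rfl fun l _ => ?_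
  rw [map_mul, ← algebraMap_eq, AlgHom.commutes]
  rfl

variable (p : Ideal (MvPolynomial (Fin (N + 1)) ℂ)) [hp : p.IsPrime]

noncomputable instance algebraAtPrime : Algebra ℂ (AtPrime (homogeneousSubmodule (Fin (N + 1)) ℂ) p) :=
  ((fromZeroRingHom (homogeneousSubmodule (Fin (N + 1)) ℂ) p.primeCompl).comp (algebraMap ℂ (homogeneousSubmodule (Fin (N + 1)) ℂ 0))).toAlgebra

lemma val_algebraMap_atPrime (c : ℂ) : (algebraMap ℂ (AtPrime (homogeneousSubmodule (Fin (N + 1)) ℂ) p) c).val =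
    algebraMap (MvPolynomial (Fin (N + 1)) ℂ) (Localization.AtPrime p) (C c) :=
  Localization.mk_one_eq_algebraMap (C c)

lemma isUnit_mk_iff (x : NumDenSameDeg (homogeneousSubmodule (Fin (N + 1)) ℂ) p.primeCompl) :
    IsUnit (HomogeneousLocalization.mk x) ↔ (x.num : MvPolynomial (Fin (N + 1)) ℂ) ∉ p := by
  rw [← isUnit_iff_isUnit_val, val_mk, Localization.mk_eq_mk',
    IsLocalization.AtPrime.isUnit_mk'_iff]
  rfl

lemma mk_mem_maximalIdeal_iff (x : NumDenSameDeg (homogeneousSubmodule (Fin (N + 1)) ℂ) p.primeCompl) :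
    HomogeneousLocalization.mk x ∈ IsLocalRing.maximalIdeal (AtPrime (homogeneousSubmodule (Fin (N + 1)) ℂ) p) ↔
      (x.num : MvPolynomial (Fin (N + 1)) ℂ) ∈ p := by
  rw [IsLocalRing.mem_maximalIdeal, mem_nonunits_iff, isUnit_mk_iff, not_not]

variable {p}

lemma val_aeval_atPrime (u : Fin N → AtPrime (homogeneousSubmodule (Fin (N + 1)) ℂ) p) (q : MvPolynomial (Fin N) ℂ) :
    (aeval u q).val = aeval (fun i => (u i).val) q := by
  induction q using MvPolynomial.induction_on with
  | C c =>
    rw [← MvPolynomial.algebraMap_eq, AlgHom.commutes, AlgHom.commutes, val_algebraMap_atPrime]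
    rfl
  | add p q hp hq => rw [map_add, map_add, val_add, hp, hq]
  | mul_X p i hp => rw [map_mul, map_mul, val_mul, hp, aeval_X, aeval_X]

/-- The affine coordinates defined by the rows of a matrix. -/
noncomputable def affineCoord (A' : Matrix (Fin (N + 1)) (Fin (N + 1)) ℂ)
    (h0 : linForm (A' 0) ∉ p) (i : Fin N) : AtPrime (homogeneousSubmodule (Fin (N + 1)) ℂ) p :=
  .mk ⟨1, ⟨linForm (A' i.succ), linForm_mem _⟩, ⟨linForm (A' 0), linForm_mem _⟩, h0⟩

variable {A A' : Matrix (Fin (N + 1)) (Fin (N + 1)) ℂ}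

/-- Homogeneity allows the form `linForm (A' 0)` to be factored out of the coordinates; since `A'`
inverts `A`, what is left is `H ∘ A` at `(1, t)`, with `t` the affine coordinates. -/
lemma algebraMap_eq_pow_mul_aeval (hA : A * A' = 1) (h0 : linForm (A' 0) ∉ p) {n : ℕ}
    {H : MvPolynomial (Fin (N + 1)) ℂ} (hH : H.IsHomogeneous n) :
    algebraMap _ (Localization.AtPrime p) H =
      algebraMap _ (Localization.AtPrime p) (linForm (A' 0)) ^ n *
        (aeval (affineCoord A' h0) (dehom N (aeval (fun i => linForm (A i)) H))).val := by
  have hH' : (aeval (fun i => linForm (A i)) H).IsHomogeneous n := by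
    have := hH.aeval (n := 1) (fun i => linForm (A i)) fun i => linForm_mem (A i)
    rwa [one_mul] at this
  have e1 : (aeval (affineCoord A' h0) (dehom N (aeval (fun i => linForm (A i)) H))).val =
      aeval (Fin.cons 1 fun i => (affineCoord A' h0 i).val : Fin (N + 1) → Localization.AtPrime p)
        (aeval (fun i => linForm (A i)) H) := by
    rw [val_aeval_atPrime, dehom, ← AlgHom.comp_apply, comp_aeval]
    congr 2
    funext i
    cases i using Fin.cases <;> simp
  rw [e1, ← hH'.aeval_mul_left]
  have e2 : (fun i => algebraMap _ (Localization.AtPrime p) (linForm (A' 0)) *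
      (Fin.cons 1 fun i => (affineCoord A' h0 i).val : Fin (N + 1) → Localization.AtPrime p) i) =
      fun i => Algebra.algHom ℂ (MvPolynomial (Fin (N + 1)) ℂ) (Localization.AtPrime p)
        (linForm (A' i)) := by
    funext i
    cases i using Fin.cases with
    | zero => simp; rfl
    | succ i =>
      rw [Fin.cons_succ, affineCoord, val_mk, Localization.mk_eq_mk', mul_comm]
      exact IsLocalization.mk'_spec _ _ _
  rw [e2, ← comp_aeval, AlgHom.comp_apply, aeval_linForm_linForm hA]
  rfl

/-- Splits a fraction into a polynomial in the affine coordinates and a fraction whose numerator, a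
power of `linForm (A' 0)`, lies outside `p` and which is therefore a unit. -/
lemma mk_eq_aeval_mul (hA : A * A' = 1) (h0 : linForm (A' 0) ∉ p)
    (x : NumDenSameDeg (homogeneousSubmodule (Fin (N + 1)) ℂ) p.primeCompl) :
    HomogeneousLocalization.mk x =
      aeval (affineCoord A' h0) (dehom N (aeval (fun i => linForm (A i)) (x.num : MvPolynomial _ ℂ))) *
        .mk ⟨x.deg, ⟨linForm (A' 0) ^ x.deg, by
          have := SetLike.pow_mem_graded x.deg (linForm_mem (A' 0))
          rwa [smul_eq_mul, mul_one] at this⟩, x.den, x.den_mem⟩ := by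
  apply val_injective
  rw [val_mul, val_mk, val_mk, Localization.mk_eq_mk',
    IsLocalization.mk'_eq_iff_eq_mul, mul_assoc, IsLocalization.mk'_spec, map_pow, mul_comm]
  exact algebraMap_eq_pow_mul_aeval hA h0 x.num.2

variable {v : Fin (N + 1) → ℂ}

/-- Up to a unit, an element of the maximal ideal is a polynomial in the affine coordinates. The
coordinates are centred at `v`, so its constant term is a multiple of the value at `v`, which is
zero. -/
theorem maximalIdeal_atPrime_eq_span (hA : A * A' = 1) (h0 : linForm (A' 0) ∉ p)
    (hp : ∀ n, ∀ H ∈ homogeneousSubmodule (Fin (N + 1)) ℂ n, H ∈ p ↔ eval v H = 0) {c : ℂ}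
    (hc : c ≠ 0) (hv : v = c • A.mulVec (Pi.single 0 1)) :
    IsLocalRing.maximalIdeal (AtPrime (homogeneousSubmodule (Fin (N + 1)) ℂ) p) = Ideal.span (Set.range (affineCoord A' h0)) := by
  have hA' : A' * A = 1 := mul_eq_one_comm.1 hA
  apply le_antisymm
  · intro r hr
    obtain ⟨x, rfl⟩ := mk_surjective r
    rw [mk_mem_maximalIdeal_iff] at hr
    rw [mk_eq_aeval_mul hA h0]
    refine Ideal.mul_mem_right _ _ ?_
    have h1 : eval (A.mulVec (Pi.single 0 1)) (x.num : MvPolynomial (Fin (N + 1)) ℂ) = 0 := by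
      have h2 := (hp _ _ x.num.2).1 hr
      have h3 : MvPolynomial.IsHomogeneous (x.num : MvPolynomial (Fin (N + 1)) ℂ) x.deg := x.num.2
      rw [hv, h3.eval_smul'] at h2
      exact (mul_eq_zero.1 h2).resolve_left (pow_ne_zero _ hc)
    rw [← eval_aeval_linForm] at h1
    have h2 : dehom N (aeval (fun i => linForm (A i)) (x.num : MvPolynomial (Fin (N + 1)) ℂ)) ∈
        idealOfVars (Fin N) ℂ := by
      rw [← pow_one (idealOfVars (Fin N) ℂ), mem_pow_idealOfVars_iff']
      intro m hm
      have hm0 : m = 0 := by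
        rw [← Finsupp.degree_eq_zero_iff]; omega
      rw [hm0, ← constantCoeff_eq, ← eval_zero', dehom, eval_aeval_eq]
      refine (congrArg (fun w => eval w _) (funext fun i => ?_)).trans h1
      cases i using Fin.cases <;> simp
    have h3 := Ideal.mem_map_of_mem (aeval (affineCoord A' h0)) h2
    rw [idealOfVars, Ideal.map_span, ← Set.range_comp] at h3
    convert h3 using 3
    funext i
    simp
  · rw [Ideal.span_le]
    rintro _ ⟨i, rfl⟩
    refine (mk_mem_maximalIdeal_iff p _).2 ((hp 1 _ (linForm_mem _)).2 ?_)
    rw [eval_linForm, hv, Matrix.mulVec_smul, Matrix.mulVec_mulVec, hA', Matrix.one_mulVec]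
    simp

theorem exists_sub_algebraMap_mem_maximalIdeal
    (hp : ∀ n, ∀ H ∈ homogeneousSubmodule (Fin (N + 1)) ℂ n, H ∈ p ↔ eval v H = 0)
    (r : AtPrime (homogeneousSubmodule (Fin (N + 1)) ℂ) p) :
    ∃ c : ℂ, r - algebraMap ℂ _ c ∈ IsLocalRing.maximalIdeal (AtPrime (homogeneousSubmodule (Fin (N + 1)) ℂ) p) := by
  obtain ⟨x, rfl⟩ := mk_surjective r
  let c := eval v (x.num : MvPolynomial (Fin (N + 1)) ℂ) / eval v (x.den : MvPolynomial (Fin (N + 1)) ℂ)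
  have hmem : (x.num : MvPolynomial (Fin (N + 1)) ℂ) - C c * (x.den : MvPolynomial (Fin (N + 1)) ℂ) ∈
      homogeneousSubmodule (Fin (N + 1)) ℂ x.deg :=
    Submodule.sub_mem _ x.num.2 (IsHomogeneous.C_mul x.den.2 c)
  refine ⟨c, ?_⟩
  have e : HomogeneousLocalization.mk x - algebraMap ℂ _ c = .mk ⟨x.deg, ⟨_, hmem⟩, x.den, x.den_mem⟩ := by
    apply val_injective
    rw [val_sub, val_algebraMap_atPrime, val_mk, val_mk, Localization.mk_eq_mk',
      eq_comm, IsLocalization.mk'_eq_iff_eq_mul, sub_mul,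
      IsLocalization.mk'_spec, map_sub, map_mul]
  rw [e, mk_mem_maximalIdeal_iff]
  refine (hp _ _ hmem).2 ?_
  have hden : eval v (x.den : MvPolynomial (Fin (N + 1)) ℂ) ≠ 0 := fun h =>
    x.den_mem ((hp _ _ x.den.2).2 h)
  simp only [map_sub, map_mul, eval_C, c]
  field_simp
  ring

end LocalRing

lemma RingEquiv.apply_mem_maximalIdeal_iff {R S : Type} [CommRing R] [IsLocalRing R] [CommRing S]
    [IsLocalRing S] (e : R ≃+* S) (r : R) :
    e r ∈ IsLocalRing.maximalIdeal S ↔ r ∈ IsLocalRing.maximalIdeal R := by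
  rw [IsLocalRing.mem_maximalIdeal, IsLocalRing.mem_maximalIdeal, mem_nonunits_iff,
    mem_nonunits_iff, MulEquiv.isUnit_map]

/-- Transports the `ℂ`-algebra structure along `e`, so that the bound for homogeneous localizations
applies to stalks of the scheme. -/
theorem length_quotient_le_of_ringEquiv {N : ℕ} {R S : Type} [CommRing R] [IsLocalRing R]
    [Algebra ℂ R] [CommRing S] [IsLocalRing S] (e : R ≃+* S) {t : Fin N → R}
    (hm : IsLocalRing.maximalIdeal R = Ideal.span (Set.range t))
    (hres : ∀ r : R, ∃ c : ℂ, r - algebraMap ℂ R c ∈ IsLocalRing.maximalIdeal R)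
    {f : Fin N → MvPolynomial (Fin N) ℂ} {M : ℕ} (hf : SquarefreeSpans f M) (hM : 2 ^ N < M)
    (I : Ideal S) (hI : ∀ s, e (aeval t (f s)) ∈ I) :
    Module.length S (S ⧸ I) ≤ ((2 ^ N : ℕ) : ℕ∞) := by
  let _ : Algebra ℂ S := ((e : R →+* S).comp (algebraMap ℂ R)).toAlgebra
  let e' : R →ₐ[ℂ] S := { (e : R →+* S) with commutes' := fun _ => rfl }
  have hmem := e.apply_mem_maximalIdeal_iff
  refine length_quotient_le_of_squarefreeSpans (t := fun i => e (t i)) ?_ ?_ hf hM I ?_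
  · apply le_antisymm
    · intro s hs
      obtain ⟨r, rfl⟩ := e.surjective s
      rw [hmem, hm] at hs
      have := Ideal.mem_map_of_mem (e : R →+* S) hs
      rwa [Ideal.map_span, ← Set.range_comp] at this
    · rw [Ideal.span_le]
      rintro _ ⟨i, rfl⟩
      refine (hmem _).2 ?_
      rw [hm]
      exact Ideal.subset_span ⟨i, rfl⟩
  · intro s
    obtain ⟨r, rfl⟩ := e.surjective s
    obtain ⟨c, hc⟩ := hres r
    refine ⟨c, ?_⟩
    rw [← hmem, map_sub] at hc
    exact hc
  · intro s
    have h : e' (aeval t (f s)) = aeval (fun i => e (t i)) (f s) := by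
      rw [← AlgHom.comp_apply, comp_aeval]
      rfl
    rw [← h]
    exact hI s

/-! ### From the spanning condition to multiplicities -/

namespace GenEnd

lemma mem_closedPoint_iff {ι : Type} (x : ℙ ℂ (ι → ℂ)) {n : ℕ} {H : MvPolynomial ι ℂ}
    (hH : H ∈ homogeneousSubmodule ι ℂ n) :
    H ∈ (closedPoint x).asHomogeneousIdeal.toIdeal ↔ eval x.rep H = 0 := by
  constructor
  · exact fun h => Ideal.toIdeal_homogeneousCore_le _ _ h
  · exact fun h => Ideal.mem_homogeneousCore_of_homogeneous_of_mem ⟨n, hH⟩ h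

variable {N d : ℕ}

lemma substHom_linForm (hd : 0 < d) (F : FormTuple N d) (hF : NoCommonZero F)
    (γ : Fin (N + 1) → ℂ) :
    (substHom hd F hF).toRingHom (linForm γ) = ∑ l, C (γ l) * (F l : MvPolynomial _ ℂ) := by
  change aeval _ (linForm γ) = _
  simp [linForm, ← algebraMap_eq]

/-- Take affine coordinates centred at `x` and at its image. The coordinates at the image pull back,
up to units, to the dehomogenized forms `B ∘ F ∘ A`, so these lie in the ideal that defines the
multiplicity. -/
theorem multiplicity_endOfForms_le (hd : 0 < d) (F : FormTuple N d) (hF : NoCommonZero F) {M : ℕ}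
    (hM : 2 ^ N < M)
    (hgood : ∀ (i k : Fin (N + 1)) (a b : Fin N → ℂ),
      (∀ s : Fin N, eval (Pi.single 0 1)
        (transform (chart i a) (chartInv k b) (fun j => (F j : MvPolynomial _ ℂ)) s.succ) = 0) →
      SquarefreeSpans (fun s : Fin N => dehom N
        (transform (chart i a) (chartInv k b) (fun j => (F j : MvPolynomial _ ℂ)) s.succ)) M)
    (x : ℙ ℂ (Fin (N + 1) → ℂ)) :
    multiplicity (endOfForms hd F hF) (complexPoint x) ≤ ((2 ^ N : ℕ) : ℕ∞) := by
  obtain ⟨i, a, c, hc, hv⟩ := exists_eq_smul_chart x.rep_nonzero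
  have hw0 : (fun j => eval x.rep (F j : MvPolynomial (Fin (N + 1)) ℂ)) ≠ 0 := fun h =>
    x.rep_nonzero (hF _ fun j => congrFun h j)
  obtain ⟨k, b, c', hc', hw⟩ := exists_eq_smul_chart hw0
  set A := chart i a
  set B := chartInv k b
  have hA : A * chartInv i a = 1 := chart_mul_chartInv i a
  have hBw : ∀ j, B.mulVec (fun j => eval x.rep (F j : MvPolynomial (Fin (N + 1)) ℂ)) j =
      c' * (Pi.single 0 1 : Fin (N + 1) → ℂ) j := by
    intro j
    rw [hw, Matrix.mulVec_smul, Matrix.mulVec_mulVec, chartInv_mul_chart, Matrix.one_mulVec]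
    rfl
  have hFA : ∀ j, eval x.rep (F j : MvPolynomial (Fin (N + 1)) ℂ) =
      c ^ d * eval (A.mulVec (Pi.single 0 1)) (F j : MvPolynomial (Fin (N + 1)) ℂ) := by
    intro j
    have h : MvPolynomial.IsHomogeneous (F j : MvPolynomial (Fin (N + 1)) ℂ) d := (F j).2
    rw [hv, h.eval_smul']
  have hspans := hgood i k a b fun s => by
    rw [eval_transform]
    have h := hBw s.succ
    rw [show (fun j => eval x.rep (F j : MvPolynomial (Fin (N + 1)) ℂ)) = c ^ d • fun j =>
      eval (A.mulVec (Pi.single 0 1)) (F j : MvPolynomial (Fin (N + 1)) ℂ) from funext hFA,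
      Matrix.mulVec_smul, Pi.single_eq_of_ne (Fin.succ_ne_zero s), mul_zero] at h
    exact (mul_eq_zero.1 h).resolve_left (pow_ne_zero _ hc)
  let φ := substHom hd F hF
  let q := closedPoint x
  have hp : ∀ n, ∀ H ∈ homogeneousSubmodule (Fin (N + 1)) ℂ n,
    H ∈ q.asHomogeneousIdeal.toIdeal ↔ eval x.rep H = 0 := fun n H hH => mem_closedPoint_iff x hH
  have h0 : linForm (chartInv i a 0) ∉ q.asHomogeneousIdeal.toIdeal := by
    rw [hp 1 _ (linForm_mem _), eval_linForm, hv, Matrix.mulVec_smul, Matrix.mulVec_mulVec,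
      chartInv_mul_chart, Matrix.one_mulVec]
    simpa using hc
  have hφ : ∀ j, φ.toRingHom (linForm (B j)) ∈ q.asHomogeneousIdeal.toIdeal ↔
      c' * (Pi.single 0 1 : Fin (N + 1) → ℂ) j = 0 := by
    intro j
    rw [hp (d * 1) _ (φ.map_mem (linForm_mem _)), substHom_linForm, ← hBw]
    simp [Matrix.mulVec, dotProduct]
  have hB0 : linForm (B 0) ∉ (φ.comap q).asHomogeneousIdeal.toIdeal := fun h =>
    hc' (by simpa using (hφ 0).1 h)
  let e : AtPrime (homogeneousSubmodule (Fin (N + 1)) ℂ) q.asHomogeneousIdeal.toIdeal ≃+*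
    (ProjSpace N).presheaf.stalk (complexPoint x) := (Proj.stalkIso' _ q).symm
  refine length_quotient_le_of_ringEquiv e
    (maximalIdeal_atPrime_eq_span hA h0 hp hc hv)
    (exists_sub_algebraMap_mem_maximalIdeal hp) hspans hM _ ?_
  intro s
  -- The `s`-th affine coordinate centred at the image of `x`.
  let z : AtPrime (homogeneousSubmodule (Fin (N + 1)) ℂ) (φ.comap q).asHomogeneousIdeal.toIdeal :=
    .mk ⟨1, ⟨linForm (B s.succ), linForm_mem _⟩, ⟨linForm (B 0), linForm_mem _⟩, hB0⟩
  have hz : z ∈ IsLocalRing.maximalIdeal _ :=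
    (mk_mem_maximalIdeal_iff _ _).2 ((hφ s.succ).2 (by simp))
  let e₁ : AtPrime (homogeneousSubmodule (Fin (N + 1)) ℂ)
      (φ.comap q).asHomogeneousIdeal.toIdeal ≃+*
      (ProjSpace N).presheaf.stalk (endOfForms hd F hF (complexPoint x)) :=
    (Proj.stalkIso' _ (φ.comap q)).symm
  have hz' := (e₁.apply_mem_maximalIdeal_iff z).2 hz
  have hmem := Ideal.mem_map_of_mem ((endOfForms hd F hF).stalkMap (complexPoint x)).hom hz'
  have hst : ((endOfForms hd F hF).stalkMap (complexPoint x)).hom (e₁ z) =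
      e (φ.localHom q z) := φ.stalkMap_symm_apply q z
  rw [hst] at hmem
  have hK := mk_eq_aeval_mul hA h0 (φ.mapFrac q ⟨1, ⟨linForm (B s.succ), linForm_mem _⟩,
    ⟨linForm (B 0), linForm_mem _⟩, hB0⟩)
  have hT : aeval (fun i => linForm (A i)) (φ.toRingHom (linForm (B s.succ))) =
      transform A B (fun j => (F j : MvPolynomial _ ℂ)) s.succ := by
    rw [substHom_linForm, transform_eq_aeval_linForm]
  change φ.localHom q z = aeval _ (dehom N (aeval _ (φ.toRingHom (linForm (B s.succ))))) * _ at hK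
  rw [hT] at hK
  rw [hK, map_mul] at hmem
  -- The remaining factor is a power of the denominator of the source chart over the pullback of the
  -- denominator of the target chart.
  refine (Ideal.mul_unit_mem_iff_mem _ (IsUnit.map _ ?_)).1 hmem
  rw [isUnit_mk_iff]
  exact fun h => h0 (Ideal.IsPrime.mem_of_pow_mem q.isPrime _ h)

end GenEnd

/-! ### Zariski topology of the space of endomorphisms and the conclusion -/

namespace GenEnd

variable {N d : ℕ}

lemma formOf_coeffMap (F : FormTuple N d) :
    formOf (coeffMap N d F) = fun j => (F j : MvPolynomial (Fin (N + 1)) ℂ) :=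
  formOf_coeff fun j => (F j).2

/-- The two coefficient vectors are representatives of the same point and differ by a nonzero
scalar, which does not affect the vanishing of a homogeneous polynomial. -/
lemma eval_coeffPoint_rep_eq_zero_iff (f : HomSpace N d) {n : ℕ}
    {P : MvPolynomial (CoeffIndex N d) ℂ} (hP : P.IsHomogeneous n) :
    eval f.coeffPoint.rep P = 0 ↔ eval (coeffMap N d f.1.rep) P = 0 := by
  have hne : coeffMap N d f.1.rep ≠ 0 := fun h =>
    f.1.rep_nonzero (coeffMap_injective N d (h.trans (map_zero _).symm))
  have hmk : f.coeffPoint = Projectivization.mk ℂ (coeffMap N d f.1.rep) hne := by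
    rw [HomSpace.coeffPoint]
    conv_lhs => rw [← f.1.mk_rep]
    rw [Projectivization.map_mk]
  obtain ⟨c, hc⟩ := Projectivization.exists_smul_eq_mk_rep ℂ _ hne
  rw [hmk, ← hc, Units.smul_def, hP.eval_smul', mul_eq_zero, or_iff_right]
  exact pow_ne_zero _ c.ne_zero

/-- The endomorphisms whose coefficients are not a zero of `P`. -/
def nonvanishing (N : ℕ) {d : ℕ} (P : MvPolynomial (CoeffIndex N d) ℂ) : Set (HomSpace N d) :=
  {f | eval (coeffMap N d f.1.rep) P ≠ 0}

lemma nonvanishing_eq_preimage {n : ℕ} {P : MvPolynomial (CoeffIndex N d) ℂ}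
    (hP : P.IsHomogeneous n) : nonvanishing N P =
      (fun f : HomSpace N d => closedPoint f.coeffPoint) ⁻¹'
        (ProjectiveSpectrum.basicOpen (homogeneousSubmodule (CoeffIndex N d) ℂ) P : Set _) := by
  ext f
  refine (not_congr ?_)
  rw [← eval_coeffPoint_rep_eq_zero_iff f hP]
  exact (mem_closedPoint_iff f.coeffPoint hP).symm

lemma isOpen_nonvanishing {n : ℕ} {P : MvPolynomial (CoeffIndex N d) ℂ}
    (hP : P.IsHomogeneous n) : IsOpen (nonvanishing N P) := by
  rw [nonvanishing_eq_preimage hP]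
  exact isOpen_induced (ProjectiveSpectrum.basicOpen _ P).isOpen

/-- A product of nonzero polynomials over `ℂ` is nonzero somewhere. Including the polynomial of
`exists_resultant` in the product ensures that the point found is an actual endomorphism. -/
lemma dense_nonvanishing {n : ℕ} {P : MvPolynomial (CoeffIndex N d) ℂ} (hP0 : P ≠ 0)
    (hP : P.IsHomogeneous n) : Dense (nonvanishing N P) := by
  rw [dense_iff_inter_open]
  rintro O hO ⟨f, hf⟩
  obtain ⟨V, hV, rfl⟩ := isOpen_induced_iff.1 hO
  obtain ⟨_, ⟨Q, rfl⟩, hfQ, hQV⟩ :=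
    (ProjectiveSpectrum.isTopologicalBasis_basic_opens
      (homogeneousSubmodule (CoeffIndex N d) ℂ)).exists_subset_of_mem_open hf hV
  -- The basic open set of `Q` may come from an inhomogeneous polynomial; a homogeneous component
  -- that does not vanish at `f` replaces it.
  obtain ⟨m, hm⟩ : ∃ m, homogeneousComponent m Q ∉
      (closedPoint f.coeffPoint).asHomogeneousIdeal.toIdeal := by
    by_contra! h
    exact hfQ ((mem_iff_homogeneousComponent_mem
      (closedPoint f.coeffPoint).asHomogeneousIdeal.isHomogeneous Q).2 h)
  have hQm := homogeneousComponent_isHomogeneous m Q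
  have hQ0 : homogeneousComponent m Q ≠ 0 := fun h => hm (by rw [h]; exact Ideal.zero_mem _)
  obtain ⟨R, -, hR0, hR, hRv⟩ := exists_resultant N d
  obtain ⟨y, hy⟩ : ∃ y, eval y (P * homogeneousComponent m Q * R) ≠ 0 := by
    by_contra! h
    refine mul_ne_zero (mul_ne_zero hP0 hQ0) hR0 (MvPolynomial.funext fun y => ?_)
    rw [h, map_zero]
  rw [map_mul, map_mul] at hy
  have hyP := left_ne_zero_of_mul (left_ne_zero_of_mul hy)
  have hyQ := right_ne_zero_of_mul (left_ne_zero_of_mul hy)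
  have hyR := right_ne_zero_of_mul hy
  let F : FormTuple N d := fun j => ⟨formOf y j, isHomogeneous_formOf y j⟩
  have hFy : coeffMap N d F = y := funext fun k => coeff_formOf y k
  have hF : NoCommonZero F := hRv y hyR
  have hF0 : F ≠ 0 := by
    intro h
    have h1 := hF (Pi.single 0 1) fun j => by rw [h]; simp
    simpa using congrFun h1 0
  obtain ⟨c, hc⟩ := Projectivization.exists_smul_eq_mk_rep ℂ F hF0
  have hrep : coeffMap N d (Projectivization.mk ℂ F hF0).rep = (c : ℂ) • y := by
    rw [← hc, Units.smul_def, map_smul, hFy]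
  let g : HomSpace N d := ⟨Projectivization.mk ℂ F hF0, fun v hv => hF v fun j => by
    have h := hv j
    rw [← hc] at h
    have h1 : (c : ℂ) * eval v (F j : MvPolynomial (Fin (N + 1)) ℂ) = 0 := by
      rw [← smul_eval]; exact h
    exact (mul_eq_zero.1 h1).resolve_left c.ne_zero⟩
  have hg : ∀ {l : ℕ} {S : MvPolynomial (CoeffIndex N d) ℂ}, S.IsHomogeneous l → eval y S ≠ 0 →
      g ∈ nonvanishing N S := by
    intro l S hS hyS
    change eval (coeffMap N d (Projectivization.mk ℂ F hF0).rep) S ≠ 0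
    rw [hrep, hS.eval_smul']
    exact mul_ne_zero (pow_ne_zero _ c.ne_zero) hyS
  refine ⟨g, hQV ?_, hg hP hyP⟩
  have h1 := hg hQm hyQ
  rw [nonvanishing_eq_preimage hQm] at h1
  intro h
  exact h1 ((mem_iff_homogeneousComponent_mem
      (closedPoint g.coeffPoint).asHomogeneousIdeal.isHomogeneous Q).1 h m)

lemma two_pow_le_factorial_mul (N : ℕ) : ((2 ^ N : ℕ) : ℕ∞) ≤ ((N.factorial * 2 ^ N : ℕ) : ℕ∞) := by
  exact_mod_cast Nat.le_mul_of_pos_left _ N.factorial_pos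

lemma maxMultiplicity_le_of_linear (f : HomSpace N 1) :
    maxMultiplicity (f.toHom one_pos) ≤ ((2 ^ N : ℕ) : ℕ∞) := by
  refine iSup_le fun x => multiplicity_endOfForms_le one_pos f.1.rep f.2 (Nat.lt_succ_self _)
    (fun i k a b h => ?_) x
  refine squarefreeSpans_of_linear
    (isHomogeneous_transform _ _ fun j => (f.1.rep j).2) (fun v hv => ?_) h _
  have h1 : (fun l => eval ((chart i a).mulVec v)
      (f.1.rep l : MvPolynomial (Fin (N + 1)) ℂ)) = 0 := by
    have h2 : (chartInv k b).mulVec (fun l => eval ((chart i a).mulVec v)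
      (f.1.rep l : MvPolynomial (Fin (N + 1)) ℂ)) = 0 := funext fun j => by
        rw [← eval_transform]; exact hv j
    have h3 := congrArg (chart k b).mulVec h2
    rwa [Matrix.mulVec_mulVec, chart_mul_chartInv, Matrix.one_mulVec, Matrix.mulVec_zero] at h3
  have h4 := congrArg (chartInv i a).mulVec (f.2 _ (congrFun h1))
  rwa [Matrix.mulVec_mulVec, chartInv_mul_chart, Matrix.one_mulVec, Matrix.mulVec_zero] at h4

end GenEnd

theorem mainTheorem3 (N d : ℕ) (hN : 0 < N) (hd : 0 < d) :
    ∃ U : Set (GenEnd.HomSpace N d), IsOpen U ∧ Dense U ∧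
      ∀ f ∈ U, GenEnd.maxMultiplicity (f.toHom hd) ≤ ((N.factorial * 2 ^ N : ℕ) : ℕ∞) := by
  obtain rfl | hd2 : d = 1 ∨ 2 ≤ d := by omega
  · exact ⟨Set.univ, isOpen_univ, dense_univ, fun f _ =>
      (GenEnd.maxMultiplicity_le_of_linear f).trans (GenEnd.two_pow_le_factorial_mul N)⟩
  -- The truncation order `M = 2 ^ N + 1` is the least one that the length bound allows. It exceeds
  -- 2 because `N > 0`.
  · have hM : 2 < 2 ^ N + 1 := Nat.lt_succ_of_le (Nat.le_self_pow hN.ne' 2)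
    obtain ⟨P, n, hP0, hP, hgood⟩ := exists_generic_squarefreeSpans hN hd2 hM
    refine ⟨GenEnd.nonvanishing N P, GenEnd.isOpen_nonvanishing hP,
      GenEnd.dense_nonvanishing hP0 hP, fun f hf => le_trans ?_ (GenEnd.two_pow_le_factorial_mul N)⟩
    refine iSup_le fun x =>
      GenEnd.multiplicity_endOfForms_le hd f.1.rep f.2 (Nat.lt_succ_self _) ?_ x
    have h := hgood _ hf
    rwa [GenEnd.formOf_coeffMap] at h
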